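/- **Setting.** A mechanism is a Markov kernel $M$ from an input space $\mathcal X$ to $\mathcal Y$. It is $\varepsilon$-LDP if $\Pr\{M(x)\in R\}\le e^{\varepsilon}\Pr\{M(x')\in R\}$ for all measurable $R$ and all $x,x'\in\mathcal X$. If $\mathcal X=\prod_{i=1}^d\mathcal X_i$ carries a prior $\pi$ and $\delta\in\mathbb R_{\ge0}^d$, the pair $(\pi,M)$ is $\delta$-BCDP if for all $i$, all measurable $R$ and all measurable $S_i,S_i'\subseteq\mathcal X_i$ with $\pi\{x_i\in S_i\},\pi\{x_i\in S_i'\}>0$, $$P\{M(x)\in R\mid x_i\in S_i\}\le e^{\delta_i}\,P\{M(x)\in R\mid x_i\in S_i'\},$$ where $P$ is the joint law of $x\sim\pi$ and $M(x)$. **The mechanism $M_{\mathrm{mean}}$.** Let $M_{\mathrm{LDP}}(v,\alpha,r)\in\mathbb R^m$ be a randomized channel defined for every dimension $m\ge1$, level $\alpha$, radius $r$ and $v\in\mathbb R^m$ with $\|v\|_2\le r$, which is $\alpha$-LDP whenever $\alpha,r>0$. For $x\in[-1,1]^d$ and a nonnegative nondecreasing vector $c=(c_1,\dots,c_d)$ put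 $c_0=0$ and $w_k=(c_k-c_{k-1})^2/(d-k+1)$, draw independently $Y^k\sim M_{\mathrm{LDP}}\big((x_k,\dots,x_d),\,c_k-c_{k-1},\,\sqrt{d-k+1}\big)$ for $k=1,\dots,d$, and let $M_{\mathrm{mean}}(x,c)$ be the vector with $i$-th entry $\big(\sum_{k\le i}w_kY^k_{i+1-k}\big)/\sum_{k\le i}w_k$. Rounds with $c_k=c_{k-1}$ have weight $0$ and are ignored; the $i$-th entry is $0$ if $\sum_{k\le i}w_k=0$. **The sphere-sampling channel (Duchi et al.).** For $v\in\mathbb R^m$ with $\|v\|_2\le r$ and $\alpha>0$, let $$B=\frac{\sqrt{\pi}}{2}\,m\,r\,\frac{e^\alpha+1}{e^\alpha-1}\,\frac{\Gamma(\frac{m+1}2)}{\Gamma(\frac m2+1)},$$ draw independently $K\sim\mathrm{Bern}\big(\frac{e^\alpha}{e^\alpha+1}\big)$ and $S\sim\mathrm{Bern}\big(\frac12+\frac{\|v\|_2}{2r}\big)$, put $\tilde v=(2S-1)\,rv/\|v\|_2$ (if $v=0$, replace $v/\|v\|_2$ by any fixed unit vector), and output a uniformly distributed point of $\{z\in\mathbb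 R^m:(2K-1)z^{\top}\tilde v>0,\ \|z\|_2=B\}$. **Theorem.** Let $d,n\ge1$, $\varepsilon\ge0$, $0\le\delta_1\le\dots\le\delta_d$, $q\ge0$ and $\zeta\in(0,1]$. For $j=1,\dots,n$ let $\pi^{(j)}$ be a probability measure on $[-1,1]^d$ such that for all $i\le d-1$, $$\mathrm{TV}\big(\pi^{(j)}_{x_{-i}\mid x_i\in S_i},\ \pi^{(j)}_{x_{-i}\mid x_i\in S_i'}\big)\le q$$ for all measurable $S_i,S_i'\subseteq[-1,1]$ for which $\{x_i\in S_i\}$ and $\{x_i\in S_i'\}$ have positive probability under $\pi^{(j)}$; here $x_{-i}$ denotes the coordinates other than $x_i$ and $\mathrm{TV}(P,Q)=\sup_A|P(A)-Q(A)|$. Put $\tilde\delta_i=\min\{\delta_i,\varepsilon\}$, $c_0=0$, $$c_d=\min\Big\{\log\frac{e^{\zeta\tilde\delta_1}+q-1}{q},\ \tilde\delta_d\Big\}\quad(\text{and }c_d=\tilde\delta_d\text{ if }q=0),$$ and, for $i<d$, $$c_i=\begin{cases}c_d&\text{if }c_d\le\tilde\delta_i,\\ \tilde\delta_i-\log(1+qe^{c_d}-q)&\text{otherwise.}\end{cases}$$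 Then: 1. $0\le c_1\le\dots\le c_d$. 2. For every channel $M_{\mathrm{LDP}}$ as above, the mechanism $M_{\mathrm{mean}}(\cdot,c)$ is $\varepsilon$-LDP, and $(\pi^{(j)},M_{\mathrm{mean}}(\cdot,c))$ is $\delta$-BCDP for every $j$. 3. The sphere-sampling channel is such a channel, i.e. it is $\alpha$-LDP for all $m\ge1$ and $\alpha,r>0$. If it is used as $M_{\mathrm{LDP}}$, then for all fixed $x^{(1)},\dots,x^{(n)}\in[-1,1]^d$, with $\bar x=\frac1n\sum_jx^{(j)}$ and with $\Pi$ the projection onto $[-1,1]^d$, $$\mathbb E\,\Big\|\bar x-\Pi\Big(\frac1n\sum_{j=1}^nM_{\mathrm{mean}}(x^{(j)},c)\Big)\Big\|_2^2\ \le\ C\,\min\left\{\frac{\max\{1,c_d^2\}}{n}\sum_{i=1}^d\frac1{\sum_{k=1}^i\frac{(c_k-c_{k-1})^2}{d-k+1}},\ d\right\},$$ where the expectation is over the independent runs of the mechanism, $1/0=\infty$, and $C$ is an absolute constant. In particular, as $c_d\le\varepsilon$, the factor $\max\{1,c_d^2\}$ equals $1$ if $\varepsilon\le1$. -/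

import Mathlib

open MeasureTheory ProbabilityTheory
open scoped ENNReal

noncomputable section

/-! ### Notions of privacy

A mechanism with input space `X` and output space `Y` is a Markov kernel from `X` to `Y`. -/

/-- `ε`-local differential privacy. -/
def IsLDP {X Y : Type*} [MeasurableSpace X] [MeasurableSpace Y] (κ : Kernel X Y) (ε : ℝ) : Prop :=
  ∀ R : Set Y, MeasurableSet R → ∀ x x' : X, κ x R ≤ ENNReal.ofReal (Real.exp ε) * κ x' R

/-- `P{M(x) ∈ R | x_i ∈ S}`, computed in the joint law `P = π ⊗ₘ κ` of the data `x ∼ π` and of the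
output of the mechanism `κ`. -/
def outputProbGiven {d : ℕ} {X : Fin d → Type*} [∀ i, MeasurableSpace (X i)] {Y : Type*}
    [MeasurableSpace Y] (π : Measure (∀ i, X i)) (κ : Kernel (∀ i, X i) Y)
    (i : Fin d) (S : Set (X i)) (R : Set Y) : ℝ≥0∞ :=
  (π ⊗ₘ κ) ({x | x i ∈ S} ×ˢ R) / π {x | x i ∈ S}

/-- `δ`-Bayesian coordinate differential privacy of a pair (prior, mechanism). -/
def IsBCDP {d : ℕ} {X : Fin d → Type*} [∀ i, MeasurableSpace (X i)] {Y : Type*}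
    [MeasurableSpace Y] (π : Measure (∀ i, X i)) (κ : Kernel (∀ i, X i) Y) (δ : Fin d → ℝ) :
    Prop :=
  ∀ i : Fin d, ∀ R : Set Y, MeasurableSet R →
    ∀ S S' : Set (X i), MeasurableSet S → MeasurableSet S' →
      0 < π {x | x i ∈ S} → 0 < π {x | x i ∈ S'} →
        outputProbGiven π κ i S R ≤ ENNReal.ofReal (Real.exp (δ i)) * outputProbGiven π κ i S' R

/-- Total variation distance `sup_A |P(A) - Q(A)|` of two probability measures. -/
def tvDistance {X : Type*} [MeasurableSpace X] (P Q : Measure X) : ℝ :=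
  ⨆ A : {A : Set X // MeasurableSet A}, |P.real A.1 - Q.real A.1|

/-- The conditional law of the remaining coordinates `x_{-i}` given that `x_i ∈ S`. -/
def restLawGiven {d : ℕ} {X : Fin d → Type*} [∀ i, MeasurableSpace (X i)]
    (π : Measure (∀ i, X i)) (i : Fin d) (S : Set (X i)) : Measure (∀ j : {j : Fin d // j ≠ i}, X j) :=
  (cond π {x | x i ∈ S}).map (fun x j => x j)

/-- For every coordinate except the last one, conditioning on that coordinate moves the law of the
remaining coordinates by at most `q` in total variation. -/
def HasBoundedDependence {d : ℕ} {X : Fin d → Type*} [∀ i, MeasurableSpace (X i)]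
    (π : Measure (∀ i, X i)) (q : ℝ) : Prop :=
  ∀ i : Fin d, (i : ℕ) + 1 < d →
    ∀ S S' : Set (X i), MeasurableSet S → MeasurableSet S' →
      0 < π {x | x i ∈ S} → 0 < π {x | x i ∈ S'} →
        tvDistance (restLawGiven π i S) (restLawGiven π i S') ≤ q

/-! ### Local channels on Euclidean balls -/

/-- `ℝᵐ` with the Euclidean norm. -/
abbrev Euc (m : ℕ) : Type := EuclideanSpace ℝ (Fin m)

/-- The closed Euclidean ball of radius `r` about the origin of `ℝᵐ`, as a type. -/
abbrev EucBall (m : ℕ) (r : ℝ) : Type := Metric.closedBall (0 : Euc m) r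

/-- A black-box channel `M_LDP(v, α, r)`: for every dimension `m ≥ 1`, level `α` and radius `r`, a
kernel from the ball of radius `r` in `ℝᵐ` to `ℝᵐ`. -/
abbrev ChannelFamily : Type :=
  ∀ (m : ℕ) [NeZero m] (_α r : ℝ), Kernel (EucBall m r) (Euc m)

/-- The channel is `α`-locally differentially private whenever it is run at a level `α > 0`. -/
def ChannelFamily.IsPrivate (M : ChannelFamily) : Prop :=
  ∀ (m : ℕ) [NeZero m] (α r : ℝ), 0 < α → 0 < r → IsLDP (M m α r) α

/-- The open half of the unit sphere of `ℝᵐ` on which `⟨u, z⟩ > 0`. -/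
def halfSphere {m : ℕ} (u : Euc m) : Set (Metric.sphere (0 : Euc m) 1) :=
  {z | 0 < inner ℝ u (z : Euc m)}

/-- The uniform distribution on `{z : ⟨u, z⟩ > 0, ‖z‖ = B}`: normalised surface measure on half of
the unit sphere, scaled by `B`. -/
def uniformHalfSphere {m : ℕ} (B : ℝ) (u : Euc m) : Measure (Euc m) :=
  (cond (volume : Measure (Euc m)).toSphere (halfSphere u)).map
    (fun z : Metric.sphere (0 : Euc m) 1 => B • (z : Euc m))

/-- The unit vector `v / ‖v‖`, with a fixed unit vector in place of it if `v = 0`. (For `v = 0` the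
sphere-sampling channel flips the sign of this vector with probability `1/2`, so that its law does
not depend on the unit vector that is chosen.) -/
def unitDirection {m : ℕ} [NeZero m] (v : Euc m) : Euc m :=
  if v = 0 then EuclideanSpace.single 0 1 else ‖v‖⁻¹ • v

/-- Probabilities of the two outcomes of a Bernoulli variable with parameter `p`. -/
def bernoulliWeight (p : ℝ) (b : Bool) : ℝ≥0∞ :=
  if b then ENNReal.ofReal p else ENNReal.ofReal (1 - p)

/-- `2 b - 1` for a Bernoulli outcome `b`. -/
def signOf (b : Bool) : ℝ := if b then 1 else -1

/-- The radius `B` of the output sphere of the sphere-sampling channel. -/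
def duchiRadius (m : ℕ) (α r : ℝ) : ℝ :=
  (√Real.pi / 2) * m * r * ((Real.exp α + 1) / (Real.exp α - 1)) *
    (Real.Gamma (((m : ℝ) + 1) / 2) / Real.Gamma ((m : ℝ) / 2 + 1))

/-- The output law of the sphere-sampling channel on input `v`. With independent
`K ∼ Bern(e^α / (e^α + 1))` and `S ∼ Bern(1/2 + ‖v‖ / (2r))`, the output is uniform on the half
sphere `{z : (2K - 1) ⟨z, (2S - 1) r v / ‖v‖⟩ > 0, ‖z‖ = B}` (for `r > 0`, the factor `r` in the
inner product does not change this set). -/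
def duchiLaw (m : ℕ) [NeZero m] (α r : ℝ) (v : Euc m) : Measure (Euc m) :=
  ∑ K : Bool, ∑ S : Bool,
    (bernoulliWeight (Real.exp α / (Real.exp α + 1)) K *
        bernoulliWeight (1 / 2 + ‖v‖ / (2 * r)) S) •
      uniformHalfSphere (duchiRadius m α r) ((signOf K * signOf S) • unitDirection v)

lemma measurable_unitDirection {m : ℕ} [NeZero m] :
    Measurable (unitDirection : Euc m → Euc m) := by
  unfold unitDirection
  refine Measurable.ite (measurableSet_singleton _) measurable_const ?_
  exact measurable_norm.inv.smul measurable_id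

lemma unitDirection_ne_zero {m : ℕ} [NeZero m] (v : Euc m) : unitDirection v ≠ 0 := by
  unfold unitDirection
  split_ifs with h
  · intro h0
    have := congrArg (fun w : Euc m => w 0) h0
    simp at this
  · simp [h]

lemma isOpen_halfSphere {m : ℕ} (u : Euc m) : IsOpen (halfSphere u) := by
  unfold halfSphere
  exact isOpen_lt continuous_const (by fun_prop)

lemma measurable_uniformHalfSphere {m : ℕ} (B : ℝ) :
    Measurable (uniformHalfSphere B : Euc m → Measure (Euc m)) := by
  refine Measure.measurable_of_measurable_coe _ fun R hR => ?_
  have hf : Measurable (fun z : Metric.sphere (0 : Euc m) 1 => B • (z : Euc m)) := by fun_prop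
  have hA : MeasurableSet {p : Euc m × Metric.sphere (0 : Euc m) 1 | p.2 ∈ halfSphere p.1} := by
    have : IsOpen {p : Euc m × Metric.sphere (0 : Euc m) 1 |
        (0 : ℝ) < inner ℝ p.1 (p.2 : Euc m)} :=
      isOpen_lt continuous_const (by fun_prop)
    exact this.measurableSet
  have key : (fun u : Euc m => uniformHalfSphere B u R) = fun u =>
      ((volume : Measure (Euc m)).toSphere (halfSphere u))⁻¹ *
        (volume : Measure (Euc m)).toSphere
          (halfSphere u ∩ (fun z : Metric.sphere (0 : Euc m) 1 => B • (z : Euc m)) ⁻¹' R) := by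
    funext u
    rw [uniformHalfSphere, Measure.map_apply hf hR,
      cond_apply (isOpen_halfSphere u).measurableSet]
  rw [key]
  refine Measurable.mul (Measurable.inv ?_) ?_
  · exact measurable_measure_prodMk_left hA
  · exact measurable_measure_prodMk_left (hA.inter (measurable_snd (hf hR)))

lemma isProbabilityMeasure_uniformHalfSphere {m : ℕ} (B : ℝ) {u : Euc m} (hu : u ≠ 0) :
    IsProbabilityMeasure (uniformHalfSphere B u) := by
  have hf : Measurable (fun z : Metric.sphere (0 : Euc m) 1 => B • (z : Euc m)) := by fun_prop
  have hpos : (volume : Measure (Euc m)).toSphere (halfSphere u) ≠ 0 := by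
    refine (isOpen_halfSphere u).measure_ne_zero _ ⟨⟨‖u‖⁻¹ • u, ?_⟩, ?_⟩
    · simp [norm_smul, hu]
    · have : 0 < ‖u‖ := norm_pos_iff.2 hu
      simp only [halfSphere, Set.mem_ofPred_eq, inner_smul_right, real_inner_self_eq_norm_sq]
      positivity
  have : IsProbabilityMeasure (cond (volume : Measure (Euc m)).toSphere (halfSphere u)) :=
    cond_isProbabilityMeasure hpos
  exact Measure.isProbabilityMeasure_map hf.aemeasurable

lemma bernoulliWeight_sum {p : ℝ} (h0 : 0 ≤ p) (h1 : p ≤ 1) :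
    bernoulliWeight p true + bernoulliWeight p false = 1 := by
  simp only [bernoulliWeight, if_true, Bool.false_eq_true, if_false]
  rw [← ENNReal.ofReal_add h0 (by linarith)]
  simp

lemma measurable_bernoulliWeight (b : Bool) : Measurable fun p : ℝ => bernoulliWeight p b := by
  cases b
  · simp only [bernoulliWeight, Bool.false_eq_true, if_false]; fun_prop
  · simp only [bernoulliWeight, if_true]; fun_prop

/-- The sphere-sampling channel of Duchi, Jordan and Wainwright. -/
def duchiChannel : ChannelFamily := fun m _ α r =>
  { toFun := fun v => duchiLaw m α r (v : Euc m)
    measurable' := by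
      refine Measure.measurable_of_measurable_coe _ fun R hR => ?_
      simp only [duchiLaw, Measure.finsetSum_apply, Measure.smul_apply, smul_eq_mul]
      refine Finset.measurable_sum _ fun K _ => Finset.measurable_sum _ fun S _ => ?_
      refine Measurable.mul (measurable_const.mul ?_) ?_
      · exact (measurable_bernoulliWeight S).comp (by fun_prop)
      · have hu : Measurable fun v : EucBall m r => unitDirection (v : Euc m) :=
          measurable_unitDirection.comp measurable_subtype_coe
        have hd : Measurable fun v : EucBall m r =>
            (signOf K * signOf S) • unitDirection (v : Euc m) :=
          hu.const_smul (signOf K * signOf S)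
        exact (Measure.measurable_coe hR).comp ((measurable_uniformHalfSphere _).comp hd) }

instance isMarkovKernel_duchiChannel (m : ℕ) [NeZero m] (α r : ℝ) :
    IsMarkovKernel (duchiChannel m α r) := by
  refine ⟨fun v => ⟨?_⟩⟩
  change duchiLaw m α r (v : Euc m) Set.univ = 1
  have hv : ‖(v : Euc m)‖ ≤ r := mem_closedBall_zero_iff.1 v.2
  have hr : 0 ≤ r := (norm_nonneg _).trans hv
  have hU : ∀ K S : Bool, uniformHalfSphere (duchiRadius m α r)
      ((signOf K * signOf S) • unitDirection (v : Euc m)) Set.univ = 1 := fun K S => by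
    have hne : (signOf K * signOf S) • unitDirection (v : Euc m) ≠ 0 :=
      smul_ne_zero (by cases K <;> cases S <;> simp [signOf]) (unitDirection_ne_zero _)
    exact (isProbabilityMeasure_uniformHalfSphere _ hne).measure_univ
  have he := Real.exp_pos α
  have h1 := bernoulliWeight_sum (p := Real.exp α / (Real.exp α + 1)) (by positivity)
    (by rw [div_le_one (by positivity)]; linarith)
  have h2 := bernoulliWeight_sum (p := 1 / 2 + ‖(v : Euc m)‖ / (2 * r)) (by positivity) (by
    have : ‖(v : Euc m)‖ / (2 * r) ≤ 1 / 2 := by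
      rcases hr.eq_or_lt with h | h
      · simp [← h]
      · rw [div_le_div_iff₀ (by positivity) (by norm_num)]; linarith
    linarith)
  simp only [duchiLaw, Fintype.sum_bool, Measure.add_apply, Measure.smul_apply, smul_eq_mul, hU,
    mul_one]
  rw [← mul_add, ← mul_add, h2, mul_one, mul_one, h1]

/-! ### The mean-estimation mechanism

Coordinates are numbered `0, …, d - 1`; the coordinate with index `k : Fin d` is the `(k+1)`-st. -/

/-- The cube `[-1,1]^d`, as the product of its coordinate spaces. -/
abbrev Cube (d : ℕ) : Type := Fin d → Set.Icc (-1 : ℝ) 1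

/-- A point of the cube as a vector in Euclidean space. -/
def Cube.toEuc {d : ℕ} (x : Cube d) : Euc d := WithLp.toLp 2 fun i => (x i : ℝ)

instance neZero_sub_fin {d : ℕ} (k : Fin d) : NeZero (d - (k : ℕ)) := ⟨by omega⟩

/-- The tail `(x_k, …, x_{d-1})`. -/
def Cube.tail {d : ℕ} (k : Fin d) (x : Cube d) : Euc (d - (k : ℕ)) :=
  WithLp.toLp 2 fun t => (x ⟨(k : ℕ) + (t : ℕ), by omega⟩ : ℝ)

lemma Cube.tail_mem_ball {d : ℕ} (k : Fin d) (x : Cube d) :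
    x.tail k ∈ Metric.closedBall (0 : Euc (d - (k : ℕ))) √((d - (k : ℕ) : ℕ) : ℝ) := by
  rw [mem_closedBall_zero_iff, EuclideanSpace.norm_eq]
  refine Real.sqrt_le_sqrt ?_
  calc ∑ t, ‖x.tail k t‖ ^ 2 ≤ ∑ _t : Fin (d - (k : ℕ)), (1 : ℝ) := by
        refine Finset.sum_le_sum fun t _ => ?_
        have h := (x ⟨(k : ℕ) + (t : ℕ), by omega⟩).2
        rw [sq_le_one_iff₀ (norm_nonneg _), Real.norm_eq_abs]
        exact abs_le.2 h
    _ = _ := by simp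

/-- The tail of a point of the cube as an element of the ball of radius `√(d - k)`. -/
def Cube.tailBall {d : ℕ} (k : Fin d) (x : Cube d) :
    EucBall (d - (k : ℕ)) √((d - (k : ℕ) : ℕ) : ℝ) :=
  ⟨x.tail k, x.tail_mem_ball k⟩

lemma Cube.measurable_tailBall {d : ℕ} (k : Fin d) :
    Measurable (Cube.tailBall k : Cube d → _) := by
  refine Measurable.subtype_mk ?_
  unfold Cube.tail
  fun_prop

/-- The increments `c_k - c_{k-1}`, where the vector `c` is preceded by the value `0`. -/
def budget {d : ℕ} (c : Fin d → ℝ) (k : Fin d) : ℝ :=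
  c k - if h : (k : ℕ) = 0 then 0 else c ⟨(k : ℕ) - 1, by omega⟩

/-- The weights `w_k`: squared increment over the dimension of the `k`-th tail. -/
def weight {d : ℕ} (c : Fin d → ℝ) (k : Fin d) : ℝ :=
  budget c k ^ 2 / ((d - (k : ℕ) : ℕ) : ℝ)

/-- The law of the family `(Y^k)_k` of channel outputs: `Y^k` is obtained by running the channel on
the `k`-th tail at level `c_k - c_{k-1}`, with independent randomness for different `k`. -/
def channelOutputs (M : ChannelFamily)
    [hM : ∀ (m : ℕ) [NeZero m] (α r : ℝ), IsMarkovKernel (M m α r)] {d : ℕ} (c : Fin d → ℝ) :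
    Kernel (Cube d) (∀ k : Fin d, Euc (d - (k : ℕ))) where
  toFun x := Measure.pi fun k : Fin d =>
    M (d - (k : ℕ)) (budget c k) √((d - (k : ℕ) : ℕ) : ℝ) (x.tailBall k)
  measurable' := by
    refine Measurable.measure_of_isPiSystem_of_isProbabilityMeasure
      generateFrom_pi.symm isPiSystem_pi ?_
    rintro _ ⟨s, hs, rfl⟩
    simp only [Measure.pi_pi]
    refine Finset.measurable_prod _ fun k _ => ?_
    have hk : MeasurableSet (s k) := by simpa using hs k (Set.mem_univ k)
    exact (Kernel.measurable_coe _ hk).comp (Cube.measurable_tailBall k)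

/-- The estimate `ν̂_i = (∑_{k ≤ i} w_k Y^k_{x_i}) / ∑_{k ≤ i} w_k`, where `Y^k_{x_i}` is the entry
of `Y^k` that corresponds to `x_i`. A round with zero budget has weight zero and does not enter, and
the estimate is `0` if all rounds that concern `x_i` have zero budget. -/
def weightedEstimate {d : ℕ} (c : Fin d → ℝ) (Y : ∀ k : Fin d, Euc (d - (k : ℕ))) : Euc d :=
  WithLp.toLp 2 fun i =>
    (∑ k : Fin d, if h : k ≤ i then
        Y k ⟨(i : ℕ) - (k : ℕ), by have := Fin.le_def.1 h; omega⟩ * weight c k else 0) /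
      ∑ k ∈ Finset.Iic i, weight c k

lemma measurable_weightedEstimate {d : ℕ} (c : Fin d → ℝ) : Measurable (weightedEstimate c) := by
  unfold weightedEstimate
  refine (WithLp.measurable_toLp 2 _).comp (measurable_pi_lambda _ fun i => ?_)
  refine Measurable.div_const (Finset.measurable_sum _ fun k _ => ?_) _
  split_ifs
  · fun_prop
  · fun_prop

/-- The mechanism `M_mean(x, c)` built on the channel `M`. -/
def meanMechanism (M : ChannelFamily)
    [hM : ∀ (m : ℕ) [NeZero m] (α r : ℝ), IsMarkovKernel (M m α r)] {d : ℕ} (c : Fin d → ℝ) :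
    Kernel (Cube d) (Euc d) :=
  (channelOutputs M c).map (weightedEstimate c)

instance isMarkovKernel_channelOutputs (M : ChannelFamily)
    [hM : ∀ (m : ℕ) [NeZero m] (α r : ℝ), IsMarkovKernel (M m α r)] {d : ℕ} (c : Fin d → ℝ) :
    IsMarkovKernel (channelOutputs M c) := by
  refine ⟨fun x => ?_⟩
  change IsProbabilityMeasure (Measure.pi _)
  infer_instance

instance isMarkovKernel_meanMechanism (M : ChannelFamily)
    [hM : ∀ (m : ℕ) [NeZero m] (α r : ℝ), IsMarkovKernel (M m α r)] {d : ℕ} (c : Fin d → ℝ) :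
    IsMarkovKernel (meanMechanism M c) :=
  Kernel.IsMarkovKernel.map _ (measurable_weightedEstimate c)

/-! ### The choice of the privacy vector -/

/-- The index of the last coordinate. -/
def lastIdx (d : ℕ) [NeZero d] : Fin d := ⟨d - 1, Nat.sub_one_lt (NeZero.ne d)⟩

/-- The last entry `min {log ((exp (ζ δ̃_1) + q - 1) / q), δ̃_d}` of the privacy vector, where
`δ̃_i = min {δ_i, ε}`; for `q = 0` the logarithm is read as `+∞`. -/
def privacyTop {d : ℕ} [NeZero d] (δ : Fin d → ℝ) (ε q ζ : ℝ) : ℝ :=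
  if q = 0 then min (δ (lastIdx d)) ε
  else min (Real.log ((Real.exp (ζ * min (δ 0) ε) + q - 1) / q)) (min (δ (lastIdx d)) ε)

/-- The privacy vector `c`. -/
def privacyVector {d : ℕ} [NeZero d] (δ : Fin d → ℝ) (ε q ζ : ℝ) (i : Fin d) : ℝ :=
  if i = lastIdx d then privacyTop δ ε q ζ
  else if privacyTop δ ε q ζ ≤ min (δ i) ε then privacyTop δ ε q ζ
  else min (δ i) ε - Real.log (1 + q * Real.exp (privacyTop δ ε q ζ) - q)

/-! ### Mean estimation -/

/-- Projection onto the cube `[-1,1]^d`. -/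
def projCube {d : ℕ} (y : Euc d) : Euc d := WithLp.toLp 2 fun i => max (-1) (min 1 (y i))

/-- `projCube y` is a point of the cube nearest to `y`. -/
lemma norm_sub_projCube_le {d : ℕ} (y : Euc d) (z : Cube d) :
    ‖y - projCube y‖ ≤ ‖y - z.toEuc‖ := by
  rw [EuclideanSpace.norm_eq, EuclideanSpace.norm_eq]
  refine Real.sqrt_le_sqrt (Finset.sum_le_sum fun i _ => ?_)
  have h := (z i).2
  simp only [PiLp.sub_apply, projCube, Cube.toEuc, Real.norm_eq_abs]
  refine pow_le_pow_left₀ (abs_nonneg _) ?_ 2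
  rcases max_cases (-1 : ℝ) (min 1 (y i)) with h1 | h1 <;>
    rcases min_cases (1 : ℝ) (y i) with h2 | h2 <;>
    rcases abs_cases (y i - (z i : ℝ)) with h3 | h3 <;>
    rcases abs_cases (y i - max (-1) (min 1 (y i))) with h4 | h4 <;>
    linarith [h.1, h.2]

/-- The mean-squared error of the projected average of the users' reports, for the fixed data
`x⁽¹⁾, …, x⁽ⁿ⁾` and independent runs of the mechanism `κ`. -/
def meanSquaredError {d n : ℕ} (κ : Kernel (Cube d) (Euc d)) (x : Fin n → Cube d) : ℝ≥0∞ :=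
  ∫⁻ y, ENNReal.ofReal
      (‖(n : ℝ)⁻¹ • ∑ j, (x j).toEuc - projCube ((n : ℝ)⁻¹ • ∑ j, y j)‖ ^ 2)
    ∂(Measure.pi fun j : Fin n => κ (x j))

end

/-! Privacy rests on telescoping. Round `k` sees only the coordinates from `k` on and is private at
level `c_k - c_{k-1}`. Two inputs that agree beyond coordinate `i` are therefore treated differently
only in rounds `k ≤ i`, whose levels add up to `c_i` (`meanMechanism_le`). For `i = d` this gives
LDP at level `c_d ≤ ε`.

For BCDP, passing from `x_i ∈ S` to `x_i ∈ S'` has two effects. Exchanging `x_i` itself costs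
`e^{c_i}`. The law of the other coordinates moves by at most `q` in total variation. A function with
values in `[m, e^{c_d} m]` then changes its mean by at most `q (e^{c_d} - 1) m`, hence by a factor
of at most `1 + q (e^{c_d} - 1)` (`lintegral_le_of_tvDistance_le`, `lintegral_le_of_coordinate`).
The second case in the definition of `c_i` makes the product of the two factors at most `e^{δ_i}`;
in the first case `c_d ≤ δ_i`, and the LDP bound is enough (`privacyVector_dichotomy`). The choice
of `c_d` keeps the dependence loss below the smallest clipped level, so that every `c_i` is
nonnegative.

For the error, the sphere-sampling channel is unbiased (`integral_inner_duchiLaw`), and with `r² =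
m` each output coordinate has variance at most a constant times `max(1, α²) m / α²`
(`duchiRadius_sq_div_le`). Up to the factor `max(1, c_d²)`, the weight `w_k` is thus an inverse
variance, and the weighted mean has variance of order `1 / ∑ w_k`
(`variance_coord_meanMechanism_le`). Independence of the users divides this by `n`. Projecting onto
a cube that contains the true mean only helps, and caps the error at `4` per coordinate. The
required moments of the sphere come from evaluating Gaussian integrals both in polar coordinates and
as products. -/

/-! ### The privacy vector -/

section PrivacyVector

variable {d : ℕ} [NeZero d] {δ : Fin d → ℝ} {ε q ζ : ℝ}

lemma privacyTop_le (δ : Fin d → ℝ) (ε q ζ : ℝ) :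
    privacyTop δ ε q ζ ≤ min (δ (lastIdx d)) ε := by
  unfold privacyTop
  split_ifs
  · exact le_rfl
  · exact min_le_right _ _

lemma privacyTop_nonneg (hδ : ∀ i, 0 ≤ δ i) (hε : 0 ≤ ε) (hq : 0 ≤ q) (hζ : 0 < ζ) :
    0 ≤ privacyTop δ ε q ζ := by
  have h0 : ∀ i, 0 ≤ min (δ i) ε := fun i => le_min (hδ i) hε
  unfold privacyTop
  split_ifs with h
  · exact h0 _
  · have hq' : 0 < q := lt_of_le_of_ne hq (Ne.symm h)
    refine le_min (Real.log_nonneg ?_) (h0 _)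
    rw [le_div_iff₀ hq']
    have := Real.one_le_exp (mul_nonneg hζ.le (h0 0))
    linarith

lemma one_le_one_add_mul_exp_sub {t : ℝ} (hq : 0 ≤ q) (ht : 0 ≤ t) :
    1 ≤ 1 + q * Real.exp t - q := by
  nlinarith [Real.one_le_exp ht]

/-- The logarithm in the definition of `c_d` is this inequality solved for `c_d`; for `q = 0` the
left side is `1`. -/
lemma one_add_mul_exp_privacyTop_le (hδ : ∀ i, 0 ≤ δ i) (hε : 0 ≤ ε) (hq : 0 ≤ q)
    (hζ : 0 < ζ) :
    1 + q * Real.exp (privacyTop δ ε q ζ) - q ≤ Real.exp (ζ * min (δ 0) ε) := by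
  have h1 := Real.one_le_exp (mul_nonneg hζ.le (le_min (hδ 0) hε))
  rcases hq.eq_or_lt with h | h
  · subst h; simpa using h1
  · have hpos : 0 < (Real.exp (ζ * min (δ 0) ε) + q - 1) / q := div_pos (by linarith) h
    have h2 : Real.exp (privacyTop δ ε q ζ) ≤ (Real.exp (ζ * min (δ 0) ε) + q - 1) / q := by
      rw [← Real.le_log_iff_exp_le hpos, privacyTop, if_neg h.ne']
      exact min_le_left _ _
    rw [le_div_iff₀ h] at h2
    linarith

/-- The loss through dependence is at most the smallest clipped level. This is where `ζ ≤ 1` enters,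
and it is what makes the entries `c_i` nonnegative. -/
lemma log_one_add_mul_exp_privacyTop_le (hδ : ∀ i, 0 ≤ δ i) (hε : 0 ≤ ε) (hq : 0 ≤ q)
    (hζ : 0 < ζ) (hζ1 : ζ ≤ 1) :
    Real.log (1 + q * Real.exp (privacyTop δ ε q ζ) - q) ≤ min (δ 0) ε := by
  have h1 := one_le_one_add_mul_exp_sub hq (privacyTop_nonneg hδ hε hq hζ)
  rw [Real.log_le_iff_le_exp (by linarith)]
  refine (one_add_mul_exp_privacyTop_le hδ hε hq hζ).trans (Real.exp_le_exp.2 ?_)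
  exact mul_le_of_le_one_left (le_min (hδ 0) hε) hζ1

lemma privacyVector_last (δ : Fin d → ℝ) (ε q ζ : ℝ) :
    privacyVector δ ε q ζ (lastIdx d) = privacyTop δ ε q ζ := by
  simp [privacyVector]

lemma privacyVector_nonneg (hδ : ∀ i, 0 ≤ δ i) (hmono : Monotone δ) (hε : 0 ≤ ε) (hq : 0 ≤ q)
    (hζ : 0 < ζ) (hζ1 : ζ ≤ 1) (i : Fin d) : 0 ≤ privacyVector δ ε q ζ i := by
  have ht := privacyTop_nonneg hδ hε hq hζ
  unfold privacyVector
  split_ifs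
  · exact ht
  · exact ht
  · have h1 := log_one_add_mul_exp_privacyTop_le hδ hε hq hζ hζ1
    have h2 : min (δ 0) ε ≤ min (δ i) ε := min_le_min_right _ (hmono (Fin.zero_le i))
    linarith

lemma privacyVector_le_top (hδ : ∀ i, 0 ≤ δ i) (hε : 0 ≤ ε) (hq : 0 ≤ q)
    (hζ : 0 < ζ) (i : Fin d) : privacyVector δ ε q ζ i ≤ privacyTop δ ε q ζ := by
  unfold privacyVector
  split_ifs with h1 h2
  · exact le_rfl
  · exact le_rfl
  · have := Real.log_nonneg (one_le_one_add_mul_exp_sub hq (privacyTop_nonneg hδ hε hq hζ))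
    linarith

lemma le_lastIdx (i : Fin d) : i ≤ lastIdx d := by
  rw [Fin.le_def]
  simp only [lastIdx]
  omega

/-- The amount subtracted in the second case is the same for all `i`, and the clipped levels
increase. Once the first case applies it applies from there on, with the largest value `c_d`. -/
lemma privacyVector_monotone (hδ : ∀ i, 0 ≤ δ i) (hmono : Monotone δ) (hε : 0 ≤ ε) (hq : 0 ≤ q)
    (hζ : 0 < ζ) : Monotone (privacyVector δ ε q ζ) := by
  intro i j hij
  have hm : min (δ i) ε ≤ min (δ j) ε := min_le_min_right _ (hmono hij)
  by_cases hj : j = lastIdx d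
  · rw [hj, privacyVector_last]
    exact privacyVector_le_top hδ hε hq hζ i
  by_cases hj' : privacyTop δ ε q ζ ≤ min (δ j) ε
  · have : privacyVector δ ε q ζ j = privacyTop δ ε q ζ := by
      rw [privacyVector, if_neg hj, if_pos hj']
    rw [this]
    exact privacyVector_le_top hδ hε hq hζ i
  · have hi : i ≠ lastIdx d := fun h => hj (le_antisymm (le_lastIdx j) (h ▸ hij))
    have hi' : ¬ privacyTop δ ε q ζ ≤ min (δ i) ε := fun h => hj' (h.trans hm)
    rw [privacyVector, if_neg hi, if_neg hi', privacyVector, if_neg hj, if_neg hj']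
    linarith

/-- Either the whole privacy vector respects the level `δ i`, or the entry at `i` is what is left of
`δ i` after the loss through the dependence between coordinates. -/
lemma privacyVector_dichotomy (hδ : ∀ i, 0 ≤ δ i) (hε : 0 ≤ ε) (hq : 0 ≤ q) (hζ : 0 < ζ)
    (i : Fin d) :
    privacyTop δ ε q ζ ≤ δ i ∨
      ((i : ℕ) + 1 < d ∧ Real.exp (privacyVector δ ε q ζ i) *
        (1 + q * (Real.exp (privacyTop δ ε q ζ) - 1)) ≤ Real.exp (δ i)) := by
  by_cases hi : i = lastIdx d
  · left
    rw [hi]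
    exact (privacyTop_le δ ε q ζ).trans (min_le_left _ _)
  by_cases hi' : privacyTop δ ε q ζ ≤ min (δ i) ε
  · exact Or.inl (hi'.trans (min_le_left _ _))
  · refine Or.inr ⟨?_, ?_⟩
    · by_contra h
      exact hi (Fin.ext (by simp only [lastIdx]; omega))
    · have h1 := one_le_one_add_mul_exp_sub hq (privacyTop_nonneg hδ hε hq hζ)
      have h2 : 1 + q * (Real.exp (privacyTop δ ε q ζ) - 1) =
          1 + q * Real.exp (privacyTop δ ε q ζ) - q := by ring
      rw [privacyVector, if_neg hi, if_neg hi', Real.exp_sub, Real.exp_log (by linarith), h2,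
        div_mul_cancel₀ _ (by linarith)]
      exact Real.exp_le_exp.2 (min_le_left _ _)

end PrivacyVector

/-! ### Domination of product measures -/

/-- The product outer measure is the largest one bounded on boxes by the product of the side
measures, so comparing boxes suffices and no finiteness is needed. -/
lemma MeasureTheory.Measure.pi_mono {ι : Type*} [Fintype ι] {X : ι → Type*}
    [∀ i, MeasurableSpace (X i)] {μ ν : ∀ i, Measure (X i)} (h : ∀ i, μ i ≤ ν i) :
    Measure.pi μ ≤ Measure.pi ν := by
  have key : OuterMeasure.pi (fun i => (μ i).toOuterMeasure) ≤
      OuterMeasure.pi (fun i => (ν i).toOuterMeasure) := by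
    refine OuterMeasure.le_pi.2 fun s _ => (OuterMeasure.pi_pi_le _ s).trans ?_
    exact Finset.prod_le_prod' fun i _ => h i (s i)
  refine Measure.le_iff.2 fun s hs => ?_
  simp only [Measure.pi, toMeasure_apply _ _ hs]
  exact key s

lemma MeasureTheory.Measure.pi_smul {ι : Type*} [Fintype ι] {X : ι → Type*}
    [∀ i, MeasurableSpace (X i)] (a : ι → NNReal) (ν : ∀ i, Measure (X i))
    [∀ i, SigmaFinite (ν i)] :
    Measure.pi (fun i => a i • ν i) = (∏ i, a i) • Measure.pi ν := by
  refine Measure.pi_eq fun s _ => ?_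
  simp only [Measure.smul_apply, Measure.pi_pi, ENNReal.smul_def, smul_eq_mul,
    Finset.prod_mul_distrib]
  push_cast
  rfl

/-- Composition of independent private mechanisms: the privacy factors multiply. -/
lemma MeasureTheory.Measure.pi_le_prod_smul {ι : Type*} [Fintype ι] {X : ι → Type*}
    [∀ i, MeasurableSpace (X i)] {a : ι → NNReal} {μ ν : ∀ i, Measure (X i)}
    [∀ i, SigmaFinite (ν i)] (h : ∀ i, μ i ≤ a i • ν i) :
    Measure.pi μ ≤ (∏ i, a i) • Measure.pi ν :=
  (Measure.pi_mono h).trans_eq (Measure.pi_smul a ν)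

/-! ### Privacy of the rounds -/

section Rounds

variable {d : ℕ}

lemma budget_nonneg {c : Fin d → ℝ} (hc0 : ∀ i, 0 ≤ c i) (hc : Monotone c) (k : Fin d) :
    0 ≤ budget c k := by
  unfold budget
  split_ifs with h
  · simpa using hc0 k
  · exact sub_nonneg.2 (hc (Fin.le_def.2 (by simp)))

lemma budget_le {c : Fin d → ℝ} (hc0 : ∀ i, 0 ≤ c i) (k : Fin d) : budget c k ≤ c k := by
  unfold budget
  split_ifs with h
  · simp
  · linarith [hc0 ⟨(k : ℕ) - 1, by omega⟩]

lemma sum_budget (c : Fin d → ℝ) (i : Fin d) : ∑ k ∈ Finset.Iic i, budget c k = c i := by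
  obtain ⟨i, hi⟩ := i
  induction i with
  | zero =>
    have : Finset.Iic (⟨0, hi⟩ : Fin d) = {⟨0, hi⟩} := by
      ext k; simp [Fin.le_def, Fin.ext_iff]
    simp [this, budget]
  | succ n ih =>
    have : Finset.Iic (⟨n + 1, hi⟩ : Fin d) =
        insert ⟨n + 1, hi⟩ (Finset.Iic (⟨n, by omega⟩ : Fin d)) := by
      ext k; simp [Fin.le_def, Fin.ext_iff]; omega
    rw [this, Finset.sum_insert (by simp [Fin.le_def]), ih]
    simp [budget]

variable (M : ChannelFamily)

open Classical in
/-- The law of a round, with the output of a round of zero budget replaced by `0`. -/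
noncomputable def roundLaw (c : Fin d → ℝ) (x : Cube d) (k : Fin d) : Measure (Euc (d - (k : ℕ))) :=
  if budget c k = 0 then Measure.dirac 0
  else M (d - (k : ℕ)) (budget c k) √((d - (k : ℕ) : ℕ) : ℝ) (x.tailBall k)

variable {M}

lemma roundLaw_congr {c : Fin d → ℝ} {x x' : Cube d} {k : Fin d} (h : ∀ j, k ≤ j → x j = x' j) :
    roundLaw M c x k = roundLaw M c x' k := by
  have : x.tailBall k = x'.tailBall k := by
    refine Subtype.ext ?_
    simp only [Cube.tailBall, Cube.tail]
    congr 1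
    funext t
    rw [h _ (Fin.le_def.2 (by simp))]
  simp only [roundLaw, this]

lemma roundLaw_le (hpriv : M.IsPrivate) {c : Fin d → ℝ} (hb : ∀ k, 0 ≤ budget c k)
    (x x' : Cube d) (k : Fin d) :
    roundLaw M c x k ≤ Real.toNNReal (Real.exp (budget c k)) • roundLaw M c x' k := by
  unfold roundLaw
  split_ifs with h
  · simp [h]
  · have hk : (0 : ℝ) < ((d - (k : ℕ) : ℕ) : ℝ) := by
      have := k.2
      exact_mod_cast Nat.sub_pos_of_lt this
    refine Measure.le_iff.2 fun R hR => ?_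
    exact hpriv (d - (k : ℕ)) (budget c k) √((d - (k : ℕ) : ℕ) : ℝ)
      (lt_of_le_of_ne (hb k) (Ne.symm h)) (Real.sqrt_pos.2 hk) R hR _ _

variable (M) [hM : ∀ (m : ℕ) [NeZero m] (α r : ℝ), IsMarkovKernel (M m α r)]

instance isProbabilityMeasure_roundLaw (c : Fin d → ℝ) (x : Cube d) (k : Fin d) :
    IsProbabilityMeasure (roundLaw M c x k) := by
  unfold roundLaw
  split_ifs <;> infer_instance

open Classical in
-- `IsPrivate` says nothing at level `0`. A round of zero budget has weight `0`, so its output can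
-- be replaced by a constant without changing the estimate.
lemma meanMechanism_eq_map_roundLaw (c : Fin d → ℝ) (x : Cube d) :
    meanMechanism M c x = (Measure.pi (roundLaw M c x)).map (weightedEstimate c) := by
  let f : ∀ k : Fin d, Euc (d - (k : ℕ)) → Euc (d - (k : ℕ)) :=
    fun k y => if budget c k = 0 then 0 else y
  have hf : ∀ k, Measurable (f k) := fun k => by
    by_cases h : budget c k = 0
    · simp [f, h]
    · simpa [f, h] using measurable_id'
  have h1 : roundLaw M c x = fun k =>
      (M (d - (k : ℕ)) (budget c k) √((d - (k : ℕ) : ℕ) : ℝ) (x.tailBall k)).map (f k) := by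
    funext k
    by_cases h : budget c k = 0
    · simp [roundLaw, f, h]
    · simp [roundLaw, f, h]
  have h2 : weightedEstimate c ∘ (fun (Y : ∀ k : Fin d, Euc (d - (k : ℕ))) k => f k (Y k)) =
      weightedEstimate c := by
    funext Y
    simp only [Function.comp_apply, weightedEstimate]
    congr 1
    funext i
    congr 1
    refine Finset.sum_congr rfl fun k _ => ?_
    split_ifs
    · by_cases h : budget c k = 0
      · simp [weight, h]
      · simp [f, h]
    · rfl
  have hprob : ∀ k : Fin d, IsProbabilityMeasure
      ((M (d - (k : ℕ)) (budget c k) √((d - (k : ℕ) : ℕ) : ℝ) (x.tailBall k)).map (f k)) :=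
    fun k => Measure.isProbabilityMeasure_map (hf k).aemeasurable
  have h3 := Measure.pi_map_pi (hμ := fun k => inferInstance) fun k => (hf k).aemeasurable
    (μ := M (d - (k : ℕ)) (budget c k) √((d - (k : ℕ) : ℕ) : ℝ) (x.tailBall k))
  rw [h1, ← h3,
    Measure.map_map (measurable_weightedEstimate c)
      (by fun_prop), h2,
    meanMechanism, Kernel.map_apply _ (measurable_weightedEstimate c)]
  rfl

variable {M}

/-- Two inputs that agree beyond the coordinate `i` are `c i`-indistinguishable. -/
lemma meanMechanism_le (hpriv : M.IsPrivate) {c : Fin d → ℝ} (hb : ∀ k, 0 ≤ budget c k)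
    {x x' : Cube d} (i : Fin d) (h : ∀ j, i < j → x j = x' j) (R : Set (Euc d))
    (hR : MeasurableSet R) :
    meanMechanism M c x R ≤ ENNReal.ofReal (Real.exp (c i)) * meanMechanism M c x' R := by
  classical
  -- Rounds `k ≤ i` pay their budget; later rounds receive the same tail from both inputs and cost
  -- nothing.
  have key : Measure.pi (roundLaw M c x) ≤
      (∏ k, if k ≤ i then Real.toNNReal (Real.exp (budget c k)) else 1) •
        Measure.pi (roundLaw M c x') := by
    refine Measure.pi_le_prod_smul fun k => ?_
    split_ifs with hk
    · exact roundLaw_le hpriv hb x x' k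
    · rw [one_smul]
      exact (roundLaw_congr fun j hj => h j ((not_le.1 hk).trans_le hj)).le
  have hprod : (∏ k, if k ≤ i then Real.toNNReal (Real.exp (budget c k)) else 1) =
      Real.toNNReal (Real.exp (c i)) := by
    rw [← Finset.prod_filter, ← sum_budget c i, Real.exp_sum,
      Real.toNNReal_prod_of_nonneg fun k _ => (Real.exp_pos _).le]
    refine Finset.prod_congr ?_ fun _ _ => rfl
    ext k; simp
  rw [hprod] at key
  rw [meanMechanism_eq_map_roundLaw, meanMechanism_eq_map_roundLaw,
    Measure.map_apply (measurable_weightedEstimate c) hR,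
    Measure.map_apply (measurable_weightedEstimate c) hR]
  exact key _

end Rounds

/-! ### Total variation and Bayesian privacy -/

lemma tvDistance_nonneg {X : Type*} [MeasurableSpace X] (P Q : Measure X) :
    0 ≤ tvDistance P Q :=
  Real.iSup_nonneg fun _ => abs_nonneg _

lemma measure_le_add_of_tvDistance_le {X : Type*} [MeasurableSpace X] {P Q : Measure X}
    [IsProbabilityMeasure P] [IsProbabilityMeasure Q] {q : ℝ} (h : tvDistance P Q ≤ q)
    {A : Set X} (hA : MeasurableSet A) : P A ≤ Q A + ENNReal.ofReal q := by
  -- The supremum in `tvDistance` is a real one, hence `0` on unbounded families; boundedness has to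
  -- be shown before it dominates a single set.
  have hbdd : BddAbove (Set.range fun A : {A : Set X // MeasurableSet A} =>
      |P.real A.1 - Q.real A.1|) := by
    refine ⟨1, ?_⟩
    rintro _ ⟨B, rfl⟩
    have h1 : P.real B.1 ≤ 1 := measureReal_le_one
    have h2 : Q.real B.1 ≤ 1 := measureReal_le_one
    have h3 : 0 ≤ P.real B.1 := measureReal_nonneg
    have h4 : 0 ≤ Q.real B.1 := measureReal_nonneg
    exact abs_le.2 ⟨by linarith, by linarith⟩
  have h1 : P.real A - Q.real A ≤ q :=
    ((le_abs_self _).trans (le_ciSup hbdd ⟨A, hA⟩)).trans h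
  have hq : 0 ≤ q := (tvDistance_nonneg P Q).trans h
  rw [← ofReal_measureReal (μ := P), ← ofReal_measureReal (μ := Q),
    ← ENNReal.ofReal_add measureReal_nonneg hq]
  exact ENNReal.ofReal_le_ofReal (by linarith)

/-- A function whose values are within a factor `K` of each other has nearly the same mean under
measures that are close in total variation. -/
lemma lintegral_le_of_tvDistance_le {X : Type*} [MeasurableSpace X] {P Q : Measure X}
    [IsProbabilityMeasure P] [IsProbabilityMeasure Q] {q K : ℝ} (h : tvDistance P Q ≤ q)
    (hK : 1 ≤ K) {g : X → ℝ} (hg : Measurable g) (hg0 : ∀ y, 0 ≤ g y)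
    (hgK : ∀ y y', g y ≤ K * g y') :
    ∫⁻ y, ENNReal.ofReal (g y) ∂P ≤
      ENNReal.ofReal (1 + q * (K - 1)) * ∫⁻ y, ENNReal.ofReal (g y) ∂Q := by
  have hq : 0 ≤ q := (tvDistance_nonneg P Q).trans h
  have : Nonempty X := nonempty_of_isProbabilityMeasure P
  -- All values of `g` lie in `[m, K m]`, so only the excess `g - m`, of size at most `(K - 1) m`,
  -- feels the change of measure.
  set m : ℝ := ⨅ y, g y with hm
  have hbdd : BddBelow (Set.range g) := ⟨0, by rintro _ ⟨y, rfl⟩; exact hg0 y⟩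
  have hm0 : 0 ≤ m := Real.iInf_nonneg hg0
  have hmle : ∀ y, m ≤ g y := fun y => ciInf_le hbdd y
  have hleK : ∀ y, g y ≤ K * m := fun y => by
    have h1 : g y / K ≤ m := le_ciInf fun y' => by
      rw [div_le_iff₀ (by linarith)]
      linarith [hgK y y']
    rw [div_le_iff₀ (by linarith)] at h1
    linarith
  have hsplit : ∀ (ν : Measure X) [IsProbabilityMeasure ν], ∫⁻ y, ENNReal.ofReal (g y) ∂ν =
      ENNReal.ofReal m + ∫⁻ y, ENNReal.ofReal (g y - m) ∂ν := fun ν _ => by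
    rw [← mul_one (ENNReal.ofReal m), ← measure_univ (μ := ν), ← lintegral_const,
      ← lintegral_add_left measurable_const]
    refine lintegral_congr fun y => ?_
    rw [← ENNReal.ofReal_add hm0 (sub_nonneg.2 (hmle y))]
    congr 1; ring
  have hlayer : ∀ ν : Measure X, ∫⁻ y, ENNReal.ofReal (g y - m) ∂ν =
      ∫⁻ t in Set.Ioi 0, ν {y | t < g y - m} := fun ν =>
    lintegral_eq_lintegral_meas_lt ν (Filter.Eventually.of_forall fun y => sub_nonneg.2 (hmle y))
      (hg.sub_const m).aemeasurable
  have hKm : 0 ≤ (K - 1) * m := mul_nonneg (by linarith) hm0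
  have hcmp : ∫⁻ y, ENNReal.ofReal (g y - m) ∂P ≤
      ∫⁻ y, ENNReal.ofReal (g y - m) ∂Q + ENNReal.ofReal q * ENNReal.ofReal ((K - 1) * m) := by
    rw [hlayer P, hlayer Q]
    -- Superlevel sets above `(K - 1) m` are empty, so the price `q` per level is paid only on an
    -- interval of length `(K - 1) m`.
    calc ∫⁻ t in Set.Ioi 0, P {y | t < g y - m}
        ≤ ∫⁻ t in Set.Ioi 0, (Q {y | t < g y - m} +
            (Set.Iio ((K - 1) * m)).indicator (fun _ => ENNReal.ofReal q) t) := by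
          refine lintegral_mono fun t => ?_
          by_cases ht : t < (K - 1) * m
          · rw [Set.indicator_of_mem (Set.mem_Iio.2 ht)]
            exact measure_le_add_of_tvDistance_le h
              (measurableSet_lt measurable_const (hg.sub_const m))
          · have : {y | t < g y - m} = ∅ := by
              ext y
              have := hleK y
              simp only [Set.mem_ofPred_eq, Set.mem_empty_iff_false, iff_false]
              linarith
            simp [this]
      _ = (∫⁻ t in Set.Ioi 0, Q {y | t < g y - m}) +
            ENNReal.ofReal q * ENNReal.ofReal ((K - 1) * m) := by
          rw [lintegral_add_right _ (measurable_const.indicator measurableSet_Iio),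
            lintegral_indicator measurableSet_Iio, lintegral_const,
            Measure.restrict_restrict measurableSet_Iio, Measure.restrict_apply_univ,
            Set.inter_comm, Set.Ioi_inter_Iio, Real.volume_Ioo, sub_zero]
  -- Bounding `m` by the mean under `Q` turns the additive error into a multiplicative one.
  have hmQ : ENNReal.ofReal m ≤ ∫⁻ y, ENNReal.ofReal (g y) ∂Q := by
    rw [hsplit Q]; exact le_self_add
  calc ∫⁻ y, ENNReal.ofReal (g y) ∂P
      = ENNReal.ofReal m + ∫⁻ y, ENNReal.ofReal (g y - m) ∂P := hsplit P
    _ ≤ ENNReal.ofReal m + (∫⁻ y, ENNReal.ofReal (g y - m) ∂Q +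
          ENNReal.ofReal q * ENNReal.ofReal ((K - 1) * m)) := by gcongr
    _ = ∫⁻ y, ENNReal.ofReal (g y) ∂Q + ENNReal.ofReal (q * (K - 1)) * ENNReal.ofReal m := by
        rw [hsplit Q, add_assoc, ← ENNReal.ofReal_mul hq,
          ← ENNReal.ofReal_mul (mul_nonneg hq (by linarith)), mul_assoc]
    _ ≤ ∫⁻ y, ENNReal.ofReal (g y) ∂Q +
          ENNReal.ofReal (q * (K - 1)) * ∫⁻ y, ENNReal.ofReal (g y) ∂Q := by gcongr
    _ = _ := by
        rw [ENNReal.ofReal_add zero_le_one (mul_nonneg hq (by linarith)), add_mul,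
          ENNReal.ofReal_one, one_mul]

/-! ### Averages under conditioning on one coordinate -/

section Bayesian

variable {d : ℕ} {X : Fin d → Type*}

/-- The point with `i`-th coordinate `a` and remaining coordinates `y`. -/
def insertCoord (i : Fin d) (y : ∀ j : {j : Fin d // j ≠ i}, X j) (a : X i) (j : Fin d) : X j :=
  if h : j = i then h ▸ a else y ⟨j, h⟩

lemma insertCoord_of_ne {i j : Fin d} (h : j ≠ i) (y : ∀ j : {j : Fin d // j ≠ i}, X j)
    (a : X i) : insertCoord i y a j = y ⟨j, h⟩ := by
  simp [insertCoord, h]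

lemma insertCoord_self (i : Fin d) (x : ∀ j, X j) :
    insertCoord i (fun j => x j) (x i) = x := by
  funext j
  by_cases h : j = i
  · subst h; simp [insertCoord]
  · simp [insertCoord, h]

variable [∀ i, MeasurableSpace (X i)]

lemma measurable_insertCoord (i : Fin d) :
    Measurable fun p : (∀ j : {j : Fin d // j ≠ i}, X j) × X i => insertCoord i p.1 p.2 := by
  refine measurable_pi_lambda _ fun j => ?_
  by_cases h : j = i
  · subst h; simpa [insertCoord] using measurable_snd
  · simp only [insertCoord, h, dif_neg, not_false_eq_true]
    exact (measurable_pi_apply _).comp measurable_fst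

/-- Averages of a `[0,1]`-valued function `f` under two laws: if changing one coordinate changes `f`
by a factor of at most `A`, changing all of them changes `f` by a factor of at most `K`, and the laws
of the other coordinates are close, then the averages are close. -/
lemma lintegral_le_of_coordinate {μ ν : Measure (∀ j, X j)} [IsProbabilityMeasure μ]
    [IsProbabilityMeasure ν] (i : Fin d) [StandardBorelSpace (X i)] [Nonempty (X i)]
    {q A K : ℝ} (hA : 0 ≤ A) (hK : 1 ≤ K)
    (h : tvDistance (μ.map fun x (j : {j : Fin d // j ≠ i}) => x j)
      (ν.map fun x (j : {j : Fin d // j ≠ i}) => x j) ≤ q)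
    {f : (∀ j, X j) → ℝ≥0∞} (hf : Measurable f) (hf1 : ∀ x, f x ≤ 1)
    (hfA : ∀ x x', (∀ j, j ≠ i → x j = x' j) → f x ≤ ENNReal.ofReal A * f x')
    (hfK : ∀ x x', f x ≤ ENNReal.ofReal K * f x') :
    ∫⁻ x, f x ∂μ ≤ ENNReal.ofReal (A * (1 + q * (K - 1))) * ∫⁻ x, f x ∂ν := by
  let rest : (∀ j, X j) → ∀ j : {j : Fin d // j ≠ i}, X j := fun x j => x j
  have hrest : Measurable rest := by fun_prop
  let ρ : Measure ((∀ j : {j : Fin d // j ≠ i}, X j) × X i) := ν.map fun x => (rest x, x i)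
  have hpair : Measurable fun x : (∀ j, X j) => (rest x, x i) := by fun_prop
  have : IsProbabilityMeasure ρ := Measure.isProbabilityMeasure_map hpair.aemeasurable
  have : IsProbabilityMeasure (μ.map rest) := Measure.isProbabilityMeasure_map hrest.aemeasurable
  have : IsProbabilityMeasure (ν.map rest) := Measure.isProbabilityMeasure_map hrest.aemeasurable
  have hfst : ρ.fst = ν.map rest := Measure.fst_map_prodMk (measurable_pi_apply i)
  have hfm : Measurable fun p : (∀ j : {j : Fin d // j ≠ i}, X j) × X i =>
      f (insertCoord i p.1 p.2) := hf.comp (measurable_insertCoord i)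
  -- Conditional expectation of `f` under `ν` given the other coordinates. The whole `i`-th
  -- coordinate is thereby resampled from `ν`, leaving a function to which the total variation bound
  -- applies.
  let G : (∀ j : {j : Fin d // j ≠ i}, X j) → ℝ≥0∞ :=
    fun y => ∫⁻ a, f (insertCoord i y a) ∂(ρ.condKernel y)
  have hG : Measurable G := hfm.lintegral_kernel_prod_right'
  have hG1 : ∀ y, G y ≤ 1 := fun y => by
    calc G y ≤ ∫⁻ _a, 1 ∂(ρ.condKernel y) := lintegral_mono fun a => hf1 _
      _ = 1 := by simp
  have hGtop : ∀ y, G y ≠ ∞ := fun y => ((hG1 y).trans_lt ENNReal.one_lt_top).ne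
  have hν : ∫⁻ x, f x ∂ν = ∫⁻ y, G y ∂(ν.map rest) := by
    calc ∫⁻ x, f x ∂ν = ∫⁻ x, f (insertCoord i (rest x) (x i)) ∂ν :=
          lintegral_congr fun x => by rw [insertCoord_self]
      _ = ∫⁻ p, f (insertCoord i p.1 p.2) ∂ρ := (lintegral_map hfm hpair).symm
      _ = ∫⁻ p, f (insertCoord i p.1 p.2) ∂(ρ.fst ⊗ₘ ρ.condKernel) := by
          rw [Measure.disintegrate]
      _ = ∫⁻ y, G y ∂(ν.map rest) := by rw [Measure.lintegral_compProd hfm, hfst]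
  have hle : ∀ (B : ℝ≥0∞) (x : ∀ j, X j) (y : ∀ j : {j : Fin d // j ≠ i}, X j),
      (∀ a, f x ≤ B * f (insertCoord i y a)) → f x ≤ B * G y := fun B x y hxy => by
    calc f x = ∫⁻ _a, f x ∂(ρ.condKernel y) := by simp
      _ ≤ ∫⁻ a, B * f (insertCoord i y a) ∂(ρ.condKernel y) := lintegral_mono hxy
      _ = B * G y := lintegral_const_mul _ (hfm.comp measurable_prodMk_left)
  -- Only `ν` is disintegrated: under `μ`, the value `f x` is compared pointwise with `f` after
  -- resampling `x i`, at the cost of `A`.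
  have hμ : ∫⁻ x, f x ∂μ ≤ ENNReal.ofReal A * ∫⁻ y, G y ∂(μ.map rest) := by
    rw [lintegral_map hG hrest, ← lintegral_const_mul _ (show Measurable fun x => G (rest x) from hG.comp hrest)]
    refine lintegral_mono fun x => hle _ x _ fun a => hfA _ _ fun j hj => ?_
    rw [insertCoord_of_ne hj]
  have hGK : ∀ y y', G y ≤ ENNReal.ofReal K * G y' := fun y y' => by
    calc G y ≤ ∫⁻ _a, ENNReal.ofReal K * G y' ∂(ρ.condKernel y) :=
          lintegral_mono fun a => hle _ _ _ fun _ => hfK _ _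
      _ = ENNReal.ofReal K * G y' := by simp
  have htv := lintegral_le_of_tvDistance_le h hK (g := fun y => (G y).toReal)
    hG.ennreal_toReal (fun y => ENNReal.toReal_nonneg) fun y y' => by
      have := ENNReal.toReal_mono (ENNReal.mul_ne_top ENNReal.ofReal_ne_top (hGtop y')) (hGK y y')
      rwa [ENNReal.toReal_mul, ENNReal.toReal_ofReal (by linarith)] at this
  simp only [ENNReal.ofReal_toReal (hGtop _)] at htv
  calc ∫⁻ x, f x ∂μ ≤ ENNReal.ofReal A * ∫⁻ y, G y ∂(μ.map rest) := hμ
    _ ≤ ENNReal.ofReal A * (ENNReal.ofReal (1 + q * (K - 1)) * ∫⁻ y, G y ∂(ν.map rest)) := by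
        gcongr
    _ = _ := by rw [hν, ENNReal.ofReal_mul hA, mul_assoc]

lemma outputProbGiven_eq_lintegral_cond {Y : Type*} [MeasurableSpace Y] (π : Measure (∀ i, X i))
    [IsProbabilityMeasure π] (κ : Kernel (∀ i, X i) Y) [IsMarkovKernel κ] {i : Fin d}
    {S : Set (X i)} (hS : MeasurableSet S) {R : Set Y} (hR : MeasurableSet R) :
    outputProbGiven π κ i S R = ∫⁻ x, κ x R ∂(cond π {x | x i ∈ S}) := by
  have hS' : MeasurableSet {x : ∀ i, X i | x i ∈ S} := measurable_pi_apply i hS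
  rw [outputProbGiven, Measure.compProd_apply_prod hS' hR, ProbabilityTheory.cond, lintegral_smul_measure,
    smul_eq_mul, ENNReal.div_eq_inv_mul]

end Bayesian

/-! ### Privacy of the mean-estimation mechanism -/

section MeanPrivacy

variable {d : ℕ} [NeZero d] {δ : Fin d → ℝ} {ε q ζ : ℝ}
variable {M : ChannelFamily} [hM : ∀ (m : ℕ) [NeZero m] (α r : ℝ), IsMarkovKernel (M m α r)]

lemma meanMechanism_le_last (hpriv : M.IsPrivate) {c : Fin d → ℝ} (hb : ∀ k, 0 ≤ budget c k)
    (x x' : Cube d) {R : Set (Euc d)} (hR : MeasurableSet R) :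
    meanMechanism M c x R ≤
      ENNReal.ofReal (Real.exp (c (lastIdx d))) * meanMechanism M c x' R :=
  meanMechanism_le hpriv hb (lastIdx d) (fun j hj => absurd (le_lastIdx j) hj.not_ge) R hR

lemma isLDP_meanMechanism (hpriv : M.IsPrivate) (hδ : ∀ i, 0 ≤ δ i) (hmono : Monotone δ)
    (hε : 0 ≤ ε) (hq : 0 ≤ q) (hζ : 0 < ζ) (hζ1 : ζ ≤ 1) :
    IsLDP (meanMechanism M (privacyVector δ ε q ζ)) ε := by
  intro R hR x x'
  refine (meanMechanism_le_last hpriv (budget_nonneg (privacyVector_nonneg hδ hmono hε hq hζ hζ1)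
    (privacyVector_monotone hδ hmono hε hq hζ)) x x' hR).trans ?_
  gcongr
  rw [privacyVector_last]
  exact (privacyTop_le δ ε q ζ).trans (min_le_right _ _)

lemma isBCDP_meanMechanism (hpriv : M.IsPrivate) (hδ : ∀ i, 0 ≤ δ i) (hmono : Monotone δ)
    (hε : 0 ≤ ε) (hq : 0 ≤ q) (hζ : 0 < ζ) (hζ1 : ζ ≤ 1) (π : Measure (Cube d))
    [IsProbabilityMeasure π] (hTV : HasBoundedDependence π q) :
    IsBCDP π (meanMechanism M (privacyVector δ ε q ζ)) δ := by
  intro i R hR S S' hS hS' hπS hπS'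
  set c := privacyVector δ ε q ζ with hc
  have hb := budget_nonneg (privacyVector_nonneg hδ hmono hε hq hζ hζ1)
    (privacyVector_monotone hδ hmono hε hq hζ)
  have hall := fun x x' => meanMechanism_le_last hpriv hb x x' hR
  have : IsProbabilityMeasure (cond π {x | x i ∈ S}) := cond_isProbabilityMeasure hπS.ne'
  have : IsProbabilityMeasure (cond π {x | x i ∈ S'}) := cond_isProbabilityMeasure hπS'.ne'
  have hmeas : Measurable fun x => meanMechanism M c x R := Kernel.measurable_coe _ hR
  have ht0 := privacyTop_nonneg hδ hε hq hζ
  rw [outputProbGiven_eq_lintegral_cond π _ hS hR, outputProbGiven_eq_lintegral_cond π _ hS' hR]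
  rw [privacyVector_last] at hall
  rcases privacyVector_dichotomy hδ hε hq hζ i with h | ⟨hi, h⟩
  -- Here `c_d ≤ δ i`: the bound holds for every pair of inputs, so it can be averaged over both
  -- conditional laws without any use of dependence.
  · calc ∫⁻ x, meanMechanism M c x R ∂(cond π {x | x i ∈ S})
        ≤ ∫⁻ _x, (∫⁻ x', ENNReal.ofReal (Real.exp (δ i)) * meanMechanism M c x' R
            ∂(cond π {x | x i ∈ S'})) ∂(cond π {x | x i ∈ S}) := by
          refine lintegral_mono fun x => ?_
          calc meanMechanism M c x R
              = ∫⁻ _x', meanMechanism M c x R ∂(cond π {x | x i ∈ S'}) := by simp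
            _ ≤ _ := lintegral_mono fun x' => (hall x x').trans (by gcongr)
      _ = _ := by rw [lintegral_const, measure_univ, mul_one, lintegral_const_mul _ hmeas]
  · have : Nonempty (Set.Icc (-1 : ℝ) 1) := ⟨⟨0, by norm_num⟩⟩
    refine (lintegral_le_of_coordinate i (Real.exp_pos (c i)).le (Real.one_le_exp ht0)
      (hTV i hi S S' hS hS' hπS hπS') hmeas (fun x => prob_le_one)
      (fun x x' hxx => meanMechanism_le hpriv hb i (fun j hj => hxx j hj.ne') R hR) hall).trans ?_
    -- The product of the factors for `x i` and for the dependence is at most `exp (δ i)` by `h`.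
    gcongr

end MeanPrivacy

/-! ### Moments of the uniform distribution on the sphere -/

section SphereMoments

/-- Gaussian integrals of homogeneous functions in polar coordinates. -/
lemma integral_mul_exp_neg_norm_sq {m : ℕ} [NeZero m] {g : Euc m → ℝ} {p : ℕ}
    (hg : ∀ (s : ℝ) (x : Euc m), 0 < s → g (s • x) = s ^ p * g x) :
    ∫ x, g x * Real.exp (-‖x‖ ^ 2) =
      (∫ z, g (z : Euc m) ∂(volume : Measure (Euc m)).toSphere) *
        (Real.Gamma (((m : ℝ) + p) / 2) / 2) := by
  have hm : 1 ≤ m := Nat.one_le_iff_ne_zero.2 (NeZero.ne m)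
  have hdim : Module.finrank ℝ (Euc m) = m := by simp
  have hnt : Nontrivial (Euc m) := Module.nontrivial_of_finrank_pos (R := ℝ) (by omega)
  have hrad : ∫ s : Set.Ioi (0 : ℝ), (s : ℝ) ^ p * Real.exp (-(s : ℝ) ^ 2)
      ∂(Measure.volumeIoiPow (m - 1)) = Real.Gamma (((m : ℝ) + p) / 2) / 2 := by
    simp only [Measure.volumeIoiPow, ENNReal.ofReal]
    rw [integral_withDensity_eq_integral_smul (measurable_subtype_coe.pow_const _).real_toNNReal,
      integral_subtype_comap measurableSet_Ioi
        fun s : ℝ => Real.toNNReal (s ^ (m - 1)) • (s ^ p * Real.exp (-s ^ 2))]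
    have h := integral_rpow_mul_exp_neg_rpow (p := 2) (q := (m : ℝ) - 1 + p) two_pos
      (by have : (1 : ℝ) ≤ m := by exact_mod_cast hm
          have : (0 : ℝ) ≤ p := Nat.cast_nonneg p
          linarith)
    rw [show (m : ℝ) - 1 + p + 1 = m + p by ring] at h
    rw [div_eq_inv_mul, ← one_div, ← h]
    refine setIntegral_congr_fun measurableSet_Ioi fun s hs => ?_
    have hs' : (0 : ℝ) < s := hs
    have h1 : s ^ ((m : ℝ) - 1 + p) = s ^ (m - 1) * s ^ p := by
      rw [← pow_add, ← Real.rpow_natCast]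
      congr 1
      push_cast [hm]
      ring
    simp only [NNReal.smul_def, Real.coe_toNNReal _ (pow_nonneg hs'.le _), smul_eq_mul]
    rw [h1, mul_assoc]
    norm_num
  calc ∫ x, g x * Real.exp (-‖x‖ ^ 2)
      = ∫ x : ({(0)}ᶜ : Set (Euc m)), g x * Real.exp (-‖(x : Euc m)‖ ^ 2)
          ∂((volume : Measure (Euc m)).comap (↑)) := by
        rw [integral_subtype_comap (measurableSet_singleton _).compl
          fun x : Euc m => g x * Real.exp (-‖x‖ ^ 2), restrict_compl_singleton]
    _ = ∫ y : Metric.sphere (0 : Euc m) 1 × Set.Ioi (0 : ℝ),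
          g y.1 * ((y.2 : ℝ) ^ p * Real.exp (-(y.2 : ℝ) ^ 2))
          ∂((volume : Measure (Euc m)).toSphere.prod (Measure.volumeIoiPow (m - 1))) := by
        have h := (volume : Measure (Euc m)).measurePreserving_homeomorphUnitSphereProd.integral_comp
          (Homeomorph.measurableEmbedding _)
          (fun y : Metric.sphere (0 : Euc m) 1 × Set.Ioi (0 : ℝ) =>
            g y.1 * ((y.2 : ℝ) ^ p * Real.exp (-(y.2 : ℝ) ^ 2)))
        rw [hdim] at h
        rw [← h]
        refine integral_congr_ae (Filter.Eventually.of_forall fun x => ?_)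
        have hx : 0 < ‖(x : Euc m)‖ := norm_pos_iff.2 x.2
        simp only [homeomorphUnitSphereProd_apply_fst_coe, homeomorphUnitSphereProd_apply_snd_coe]
        have h1 : g (x : Euc m) = ‖(x : Euc m)‖ ^ p * g (‖(x : Euc m)‖⁻¹ • (x : Euc m)) := by
          rw [← hg _ _ hx, smul_smul, mul_inv_cancel₀ hx.ne', one_smul]
        rw [h1]
        ring
    _ = _ := by rw [integral_prod_mul (fun z : Metric.sphere (0 : Euc m) 1 => g (z : Euc m))
          (fun s : Set.Ioi (0 : ℝ) => (s : ℝ) ^ p * Real.exp (-(s : ℝ) ^ 2)), hrad]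

lemma integral_abs_pow_mul_exp_neg_sq (p : ℕ) :
    ∫ t : ℝ, |t| ^ p * Real.exp (-t ^ 2) = Real.Gamma (((p : ℝ) + 1) / 2) := by
  have h := integral_comp_abs (f := fun t : ℝ => t ^ p * Real.exp (-t ^ 2))
  simp only [sq_abs] at h
  rw [h]
  have h2 := integral_rpow_mul_exp_neg_rpow (p := 2) (q := p) two_pos
    (by have : (0 : ℝ) ≤ p := Nat.cast_nonneg p
        linarith)
  simp only [Real.rpow_natCast, Real.rpow_ofNat] at h2
  rw [h2]
  ring

/-- The Gaussian factorises: coordinate `0` contributes the Gamma value and each of the others `√π`.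
-/
lemma integral_abs_coord_pow_mul_exp_neg_norm_sq {m : ℕ} [NeZero m] (p : ℕ) :
    ∫ x : Euc m, |x 0| ^ p * Real.exp (-‖x‖ ^ 2) =
      Real.Gamma (((p : ℝ) + 1) / 2) * √Real.pi ^ (m - 1) := by
  have hgauss : ∫ t : ℝ, Real.exp (-t ^ 2) = √Real.pi := by
    simpa using integral_gaussian 1
  rw [← (PiLp.volume_preserving_toLp (Fin m)).integral_comp
    (MeasurableEquiv.toLp 2 _).measurableEmbedding]
  have h1 : ∀ x : Fin m → ℝ, |(WithLp.toLp 2 x : Euc m) 0| ^ p *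
      Real.exp (-‖(WithLp.toLp 2 x : Euc m)‖ ^ 2) =
      ∏ i, (if i = 0 then |x i| ^ p else 1) * Real.exp (-x i ^ 2) := fun x => by
    rw [Finset.prod_mul_distrib, Finset.prod_ite_eq' Finset.univ (0 : Fin m)
      (fun i => |x i| ^ p), if_pos (Finset.mem_univ _), ← Real.exp_sum, EuclideanSpace.norm_sq_eq]
    simp [Finset.sum_neg_distrib]
  simp only [h1]
  rw [integral_fintype_prod_volume_eq_prod
    (fun (i : Fin m) (t : ℝ) => (if i = 0 then |t| ^ p else 1) * Real.exp (-t ^ 2)),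
    ← Finset.mul_prod_erase Finset.univ _ (Finset.mem_univ (0 : Fin m))]
  simp only [if_true, integral_abs_pow_mul_exp_neg_sq]
  congr 1
  rw [Finset.prod_congr rfl (g := fun _ => √Real.pi) fun i hi => by
    simp [Finset.ne_of_mem_erase hi, hgauss]]
  simp

/-- Two evaluations of one Gaussian moment are equated, which leaves the moment of the sphere as the
only unknown. The case `p = 0` gives the surface area, by which `p = 1, 2` are then normalised. -/
lemma integral_sphere_abs_coord_pow {m : ℕ} [NeZero m] (p : ℕ) :
    (∫ z, |(z : Euc m) 0| ^ p ∂(volume : Measure (Euc m)).toSphere) *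
        (Real.Gamma (((m : ℝ) + p) / 2) / 2) =
      Real.Gamma (((p : ℝ) + 1) / 2) * √Real.pi ^ (m - 1) := by
  rw [← integral_abs_coord_pow_mul_exp_neg_norm_sq p,
    ← integral_mul_exp_neg_norm_sq (g := fun x : Euc m => |x 0| ^ p)]
  intro s x hs
  simp [abs_mul, mul_pow, abs_of_pos hs]

lemma sphere_measureReal_mul_gamma {m : ℕ} [NeZero m] :
    (volume : Measure (Euc m)).toSphere.real Set.univ * (Real.Gamma ((m : ℝ) / 2) / 2) =
      √Real.pi * √Real.pi ^ (m - 1) := by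
  have h := integral_sphere_abs_coord_pow (m := m) 0
  have h2 : Real.Gamma 2⁻¹ = √Real.pi := by rw [← one_div, Real.Gamma_one_half_eq]
  simpa [h2] using h

lemma integral_sphere_abs_coord {m : ℕ} [NeZero m] :
    ∫ z, |(z : Euc m) 0| ∂(volume : Measure (Euc m)).toSphere =
      (volume : Measure (Euc m)).toSphere.real Set.univ *
        (Real.Gamma ((m : ℝ) / 2) / (√Real.pi * Real.Gamma (((m : ℝ) + 1) / 2))) := by
  have h := integral_sphere_abs_coord_pow (m := m) 1
  have h0 := sphere_measureReal_mul_gamma (m := m)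
  have hm : (0 : ℝ) < m := by exact_mod_cast Nat.pos_of_ne_zero (NeZero.ne m)
  have hG := Real.Gamma_pos_of_pos (s := ((m : ℝ) + 1) / 2) (by positivity)
  have hpi : 0 < √Real.pi := Real.sqrt_pos.2 Real.pi_pos
  norm_num [Real.Gamma_one] at h
  field_simp at h h0 ⊢
  linear_combination √Real.pi * h - h0

lemma integral_sphere_coord_sq {m : ℕ} [NeZero m] :
    ∫ z, ((z : Euc m) 0) ^ 2 ∂(volume : Measure (Euc m)).toSphere =
      (volume : Measure (Euc m)).toSphere.real Set.univ / m := by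
  have h := integral_sphere_abs_coord_pow (m := m) 2
  have h0 := sphere_measureReal_mul_gamma (m := m)
  have hm : (0 : ℝ) < m := by exact_mod_cast Nat.pos_of_ne_zero (NeZero.ne m)
  have hG := Real.Gamma_pos_of_pos (s := (m : ℝ) / 2) (by positivity)
  have h3 : Real.Gamma (((2 : ℕ) + 1 : ℝ) / 2) = √Real.pi / 2 := by
    rw [show ((2 : ℕ) + 1 : ℝ) / 2 = 1 / 2 + 1 by norm_num, Real.Gamma_add_one (by norm_num),
      Real.Gamma_one_half_eq]
    ring
  rw [h3, show ((m : ℝ) + (2 : ℕ)) / 2 = m / 2 + 1 by push_cast; ring,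
    Real.Gamma_add_one (by positivity)] at h
  simp only [sq_abs] at h
  rw [eq_div_iff hm.ne']
  have h5 : Real.Gamma ((m : ℝ) / 2) / 2 ≠ 0 := by positivity
  apply mul_right_cancel₀ h5
  linear_combination 2 * h - h0

end SphereMoments

/-! ### Symmetries of the sphere -/

section SphereSymmetry

open scoped Pointwise

variable {m : ℕ}

/-- The action of a linear isometry on the unit sphere. -/
noncomputable def sphereMap (L : Euc m ≃ₗᵢ[ℝ] Euc m) (z : Metric.sphere (0 : Euc m) 1) :
    Metric.sphere (0 : Euc m) 1 :=
  ⟨L z, by simp⟩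

lemma continuous_sphereMap (L : Euc m ≃ₗᵢ[ℝ] Euc m) : Continuous (sphereMap L) := by
  unfold sphereMap; fun_prop

/-- Surface measure is a multiple of the volume of the cone over a set, and an isometry carries
cones to cones. -/
lemma measurePreserving_sphereMap (L : Euc m ≃ₗᵢ[ℝ] Euc m) :
    MeasurePreserving (sphereMap L) (volume : Measure (Euc m)).toSphere
      (volume : Measure (Euc m)).toSphere := by
  refine ⟨(continuous_sphereMap L).measurable, Measure.ext fun A hA => ?_⟩
  rw [Measure.map_apply (continuous_sphereMap L).measurable hA,
    Measure.toSphere_apply' _ ((continuous_sphereMap L).measurable hA),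
    Measure.toSphere_apply' _ hA]
  congr 1
  rw [← L.measurePreserving.measure_preimage_emb L.toHomeomorph.measurableEmbedding
    (Set.Ioo (0 : ℝ) 1 • (Subtype.val '' A))]
  congr 1
  ext x
  simp only [Set.mem_smul, Set.mem_image, Set.mem_preimage]
  constructor
  · rintro ⟨s, hs, _, ⟨z, hz, rfl⟩, rfl⟩
    exact ⟨s, hs, L z, ⟨sphereMap L z, hz, rfl⟩, by simp⟩
  · rintro ⟨s, hs, _, ⟨z, hz, rfl⟩, hx⟩
    refine ⟨s, hs, L.symm z, ⟨sphereMap L.symm z, ?_, rfl⟩, ?_⟩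
    · have : sphereMap L (sphereMap L.symm z) = z := Subtype.ext (by simp [sphereMap])
      rwa [this]
    · apply L.injective
      simpa using hx

lemma measurableEmbedding_sphereMap (L : Euc m ≃ₗᵢ[ℝ] Euc m) :
    MeasurableEmbedding (sphereMap L) := by
  refine (continuous_sphereMap L).measurableEmbedding fun z w h => Subtype.ext (L.injective ?_)
  exact congrArg Subtype.val h

/-- The reflection in the hyperplane orthogonal to `u - v` works. -/
lemma exists_isometry_map_unit {u v : Euc m} (hu : ‖u‖ = 1) (hv : ‖v‖ = 1) :
    ∃ L : Euc m ≃ₗᵢ[ℝ] Euc m, L u = v :=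
  ⟨_, Submodule.reflection_sub (hu.trans hv.symm)⟩

/-- Moments of `⟨e, z⟩` do not depend on the unit vector `e`. -/
lemma integral_sphere_inner [NeZero m] {e : Euc m} (he : ‖e‖ = 1) (φ : ℝ → ℝ) :
    ∫ z, φ (inner ℝ e (z : Euc m)) ∂(volume : Measure (Euc m)).toSphere =
      ∫ z, φ ((z : Euc m) 0) ∂(volume : Measure (Euc m)).toSphere := by
  obtain ⟨L, hL⟩ := exists_isometry_map_unit (u := e) (v := EuclideanSpace.single 0 1) he (by simp)
  rw [← (measurePreserving_sphereMap L).integral_comp (measurableEmbedding_sphereMap L)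
    fun z => φ ((z : Euc m) 0)]
  refine integral_congr_ae (Filter.Eventually.of_forall fun z => ?_)
  have h : inner ℝ e (z : Euc m) = (L z) 0 := by
    rw [← L.inner_map_map, hL, EuclideanSpace.inner_single_left]
    simp
  simp only [h, sphereMap]

/-- The cone over the equator lies in the proper subspace orthogonal to `u`. -/
lemma measure_equator {u : Euc m} (hu : u ≠ 0) :
    (volume : Measure (Euc m)).toSphere {z | inner ℝ u (z : Euc m) = 0} = 0 := by
  have hcl : MeasurableSet {z : Metric.sphere (0 : Euc m) 1 | inner ℝ u (z : Euc m) = 0} :=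
    (isClosed_eq (by fun_prop) continuous_const).measurableSet
  rw [Measure.toSphere_apply' _ hcl]
  refine mul_eq_zero_of_right _ (measure_mono_null (t := ((ℝ ∙ u)ᗮ : Submodule ℝ (Euc m))) ?_ ?_)
  · rintro _ ⟨s, _, _, ⟨z, hz, rfl⟩, rfl⟩
    have hz' : inner ℝ u (z : Euc m) = 0 := hz
    simp only [SetLike.mem_coe, Submodule.mem_orthogonal_singleton_iff_inner_right,
      inner_smul_right, hz', mul_zero]
  · refine Measure.addHaar_submodule _ _ fun h => hu ?_
    have : u ∈ (ℝ ∙ u)ᗮ := h ▸ Submodule.mem_top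
    rw [Submodule.mem_orthogonal_singleton_iff_inner_right] at this
    exact inner_self_eq_zero.1 this

lemma compl_halfSphere_ae_eq {u : Euc m} (hu : u ≠ 0) :
    ((halfSphere u)ᶜ : Set (Metric.sphere (0 : Euc m) 1)) =ᵐ[(volume : Measure (Euc m)).toSphere] halfSphere (-u) := by
  have h : ∀ᵐ z : Metric.sphere (0 : Euc m) 1 ∂(volume : Measure (Euc m)).toSphere, inner ℝ u (z : Euc m) ≠ 0 := by
    rw [ae_iff]
    simpa using measure_equator hu
  filter_upwards [h] with z hz
  refine propext ?_
  change ¬ (0 < inner ℝ u (z : Euc m)) ↔ 0 < inner ℝ (-u) (z : Euc m)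
  rw [inner_neg_left, neg_pos, not_lt]
  exact ⟨fun h' => lt_of_le_of_ne h' hz, le_of_lt⟩

lemma setIntegral_halfSphere_comp (L : Euc m ≃ₗᵢ[ℝ] Euc m) (u : Euc m)
    (g : Metric.sphere (0 : Euc m) 1 → ℝ) :
    ∫ z in halfSphere u, g (sphereMap L z) ∂(volume : Measure (Euc m)).toSphere =
      ∫ z in halfSphere (L u), g z ∂(volume : Measure (Euc m)).toSphere := by
  rw [← (measurePreserving_sphereMap L).setIntegral_preimage_emb
    (measurableEmbedding_sphereMap L) g (halfSphere (L u))]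
  congr 2
  ext z
  change 0 < inner ℝ u (z : Euc m) ↔ 0 < inner ℝ (L u) (L z)
  rw [L.inner_map_map]

/-- An even function has half of its integral over a half sphere. -/
lemma setIntegral_halfSphere_of_even {u : Euc m} (hu : u ≠ 0)
    {g : Metric.sphere (0 : Euc m) 1 → ℝ} (hg : Integrable g (volume : Measure (Euc m)).toSphere)
    (heven : ∀ z, g (sphereMap (LinearIsometryEquiv.neg ℝ) z) = g z) :
    ∫ z in halfSphere u, g z ∂(volume : Measure (Euc m)).toSphere =
      (∫ z, g z ∂(volume : Measure (Euc m)).toSphere) / 2 := by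
  have h1 := integral_add_compl (isOpen_halfSphere u).measurableSet hg
  have h2 := setIntegral_halfSphere_comp (LinearIsometryEquiv.neg ℝ) u g
  simp only [heven, LinearIsometryEquiv.coe_neg] at h2
  rw [setIntegral_congr_set (compl_halfSphere_ae_eq hu), ← h2] at h1
  linarith

lemma integrable_sphere_of_continuous {g : Metric.sphere (0 : Euc m) 1 → ℝ} (hg : Continuous g) :
    Integrable g (volume : Measure (Euc m)).toSphere :=
  hg.integrable_of_hasCompactSupport (HasCompactSupport.of_compactSpace g)

lemma measureReal_halfSphere {u : Euc m} (hu : u ≠ 0) :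
    (volume : Measure (Euc m)).toSphere.real (halfSphere u) =
      (volume : Measure (Euc m)).toSphere.real Set.univ / 2 := by
  have := setIntegral_halfSphere_of_even hu (g := fun _ => 1) (integrable_const _) fun _ => rfl
  simpa only [integral_const, smul_eq_mul, mul_one, measureReal_restrict_apply_univ] using this

/-- Reflection in the line through `u` preserves the half sphere and changes the sign of the
integrand. -/
lemma setIntegral_halfSphere_inner_orthogonal {u e : Euc m} (h : inner ℝ u e = 0) :
    ∫ z in halfSphere u, inner ℝ e (z : Euc m) ∂(volume : Measure (Euc m)).toSphere = 0 := by
  set L := (ℝ ∙ u).reflection with hL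
  have hu : L u = u := Submodule.reflection_mem_subspace_eq_self (Submodule.mem_span_singleton_self u)
  have he : L e = -e := Submodule.reflection_mem_subspace_orthogonalComplement_eq_neg
    (Submodule.mem_orthogonal_singleton_iff_inner_right.2 h)
  have h1 := setIntegral_halfSphere_comp L u fun z => inner ℝ e (z : Euc m)
  have h2 : ∀ z : Metric.sphere (0 : Euc m) 1, inner ℝ e (sphereMap L z : Euc m) =
      -inner ℝ e (z : Euc m) := fun z => by
    have : inner ℝ (L e) (L z) = inner ℝ e (z : Euc m) := L.inner_map_map _ _
    rw [he, inner_neg_left] at this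
    simp only [sphereMap]
    linarith
  simp only [h2, hu] at h1
  rw [integral_neg] at h1
  linarith

/-- Only the component of `e` along `u` contributes. On the half sphere `⟨u, z⟩ = |⟨u, z⟩|`, an even
function whose integral is half of that over the sphere. -/
lemma setIntegral_halfSphere_inner [NeZero m] {u : Euc m} (hu : ‖u‖ = 1) (e : Euc m) :
    ∫ z in halfSphere u, inner ℝ e (z : Euc m) ∂(volume : Measure (Euc m)).toSphere =
      inner ℝ u e * ((∫ z, |(z : Euc m) 0| ∂(volume : Measure (Euc m)).toSphere) / 2) := by
  have hu0 : u ≠ 0 := by rintro rfl; simp at hu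
  have h1 : ∫ z in halfSphere u, inner ℝ u (z : Euc m) ∂(volume : Measure (Euc m)).toSphere =
      (∫ z, |(z : Euc m) 0| ∂(volume : Measure (Euc m)).toSphere) / 2 := by
    rw [← integral_sphere_inner hu (fun t => |t|), ← setIntegral_halfSphere_of_even hu0
      (integrable_sphere_of_continuous (by fun_prop)) fun z => by simp [sphereMap]]
    refine setIntegral_congr_fun (isOpen_halfSphere u).measurableSet fun z hz => ?_
    exact (abs_of_pos hz).symm
  have h2 := setIntegral_halfSphere_inner_orthogonal (u := u) (e := e - inner ℝ u e • u) (by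
    rw [inner_sub_right, inner_smul_right, real_inner_self_eq_norm_sq, hu]; ring)
  simp only [inner_sub_left, real_inner_smul_left] at h2
  rw [integral_sub (integrable_sphere_of_continuous (by fun_prop)).integrableOn
    ((integrable_sphere_of_continuous (by fun_prop)).const_mul _).integrableOn,
    integral_const_mul, h1] at h2
  linarith

lemma sphere_measureReal_pos [NeZero m] :
    0 < (volume : Measure (Euc m)).toSphere.real Set.univ := by
  have : Nontrivial (Euc m) := Module.nontrivial_of_finrank_pos (R := ℝ)
    (by simpa using Nat.pos_of_ne_zero (NeZero.ne m))
  have : NeZero (volume : Measure (Euc m)).toSphere := ⟨Measure.toSphere_ne_zero _⟩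
  exact measureReal_univ_pos

lemma integral_uniformHalfSphere (B : ℝ) (u : Euc m) {φ : Euc m → ℝ} (hφ : Continuous φ) :
    ∫ y, φ y ∂(uniformHalfSphere B u) =
      ((volume : Measure (Euc m)).toSphere.real (halfSphere u))⁻¹ *
        ∫ z in halfSphere u, φ (B • (z : Euc m)) ∂(volume : Measure (Euc m)).toSphere := by
  rw [uniformHalfSphere, integral_map (by fun_prop) hφ.aestronglyMeasurable,
    ProbabilityTheory.cond, integral_smul_measure, smul_eq_mul, ENNReal.toReal_inv]
  rfl

lemma uniformHalfSphere_ae_norm (B : ℝ) (u : Euc m) :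
    ∀ᵐ y ∂(uniformHalfSphere B u), ‖y‖ ≤ |B| := by
  rw [uniformHalfSphere, ae_map_iff (by fun_prop) (measurableSet_le measurable_norm measurable_const)]
  exact Filter.Eventually.of_forall fun z => by simp [norm_smul]

lemma integral_inner_uniformHalfSphere [NeZero m] (B : ℝ) {u : Euc m} (hu : ‖u‖ = 1) (e : Euc m) :
    ∫ y, inner ℝ e y ∂(uniformHalfSphere B u) =
      B * inner ℝ u e *
        (Real.Gamma ((m : ℝ) / 2) / (√Real.pi * Real.Gamma (((m : ℝ) + 1) / 2))) := by
  have hu0 : u ≠ 0 := by rintro rfl; simp at hu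
  have hpos := sphere_measureReal_pos (m := m)
  rw [integral_uniformHalfSphere B u (by fun_prop), measureReal_halfSphere hu0]
  simp only [inner_smul_right]
  rw [integral_const_mul, setIntegral_halfSphere_inner hu, integral_sphere_abs_coord]
  field_simp

/-- The square is even, so the choice of half sphere does not matter and the second moment is that
of the full sphere. -/
lemma integral_inner_sq_uniformHalfSphere [NeZero m] (B : ℝ) {u e : Euc m} (hu : u ≠ 0)
    (he : ‖e‖ = 1) :
    ∫ y, inner ℝ e y ^ 2 ∂(uniformHalfSphere B u) = B ^ 2 / m := by
  have hpos := sphere_measureReal_pos (m := m)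
  have hm : (0 : ℝ) < m := by exact_mod_cast Nat.pos_of_ne_zero (NeZero.ne m)
  rw [integral_uniformHalfSphere B u (by fun_prop), measureReal_halfSphere hu]
  simp only [inner_smul_right, mul_pow]
  rw [integral_const_mul, setIntegral_halfSphere_of_even hu
    (integrable_sphere_of_continuous (by fun_prop)) fun z => by simp [sphereMap],
    integral_sphere_inner he (fun t => t ^ 2), integral_sphere_coord_sq]
  field_simp

end SphereSymmetry

/-! ### The sphere-sampling channel -/

section Duchi

variable {m : ℕ}

/-- A mixture of `a` and `b` with weights between `l` and `u` is between `l (a + b)` and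
`u (a + b)`. -/
lemma mixture_bounds {p q s t a b : ℝ≥0∞} (hqp : q ≤ p) (hst : s + t = 1) :
    q * (a + b) ≤ p * (s * a + t * b) + q * (s * b + t * a) ∧
      p * (s * a + t * b) + q * (s * b + t * a) ≤ p * (a + b) := by
  have h : (s * a + t * b) + (s * b + t * a) = a + b := by
    calc (s * a + t * b) + (s * b + t * a) = (s + t) * a + (s + t) * b := by ring
      _ = a + b := by rw [hst, one_mul, one_mul]
  rw [← h]
  constructor
  · rw [mul_add q (s * a + t * b)]; gcongr
  · rw [mul_add p (s * a + t * b)]; gcongr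

lemma measure_halfSphere {u : Euc m} (hu : u ≠ 0) :
    (volume : Measure (Euc m)).toSphere (halfSphere u) =
      ENNReal.ofReal ((volume : Measure (Euc m)).toSphere.real Set.univ / 2) := by
  rw [← measureReal_halfSphere hu, ofReal_measureReal]

lemma half_add_div_mem {r : ℝ} {v : Euc m} (hv : ‖v‖ ≤ r) (hr : 0 < r) :
    0 ≤ 1 / 2 + ‖v‖ / (2 * r) ∧ 1 / 2 + ‖v‖ / (2 * r) ≤ 1 := by
  have h : ‖v‖ / (2 * r) ≤ 1 / 2 := by
    rw [div_le_div_iff₀ (by positivity) (by norm_num)]; linarith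
  exact ⟨by positivity, by linarith⟩

/-- The laws on two opposite half spheres add up to twice the uniform law on the sphere. -/
lemma uniformHalfSphere_add_neg (B : ℝ) {u : Euc m} (hu : u ≠ 0) {R : Set (Euc m)}
    (hR : MeasurableSet R) :
    uniformHalfSphere B u R + uniformHalfSphere B (-u) R =
      (ENNReal.ofReal ((volume : Measure (Euc m)).toSphere.real Set.univ / 2))⁻¹ *
        (volume : Measure (Euc m)).toSphere
          ((fun z : Metric.sphere (0 : Euc m) 1 => B • (z : Euc m)) ⁻¹' R) := by
  have hf : Measurable (fun z : Metric.sphere (0 : Euc m) 1 => B • (z : Euc m)) := by fun_prop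
  have hu' : -u ≠ 0 := neg_ne_zero.2 hu
  rw [uniformHalfSphere, uniformHalfSphere, Measure.map_apply hf hR, Measure.map_apply hf hR,
    cond_apply (isOpen_halfSphere u).measurableSet, cond_apply (isOpen_halfSphere _).measurableSet,
    measure_halfSphere hu, measure_halfSphere hu', ← mul_add,
    ← measure_congr (Filter.EventuallyEq.inter (compl_halfSphere_ae_eq hu)
      (Filter.EventuallyEq.refl _ ((fun z : Metric.sphere (0 : Euc m) 1 => B • (z : Euc m)) ⁻¹' R))),
    Set.inter_comm, Set.inter_comm (halfSphere u)ᶜ, ← Set.sdiff_eq,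
    measure_inter_add_sdiff _ (isOpen_halfSphere u).measurableSet]

variable [NeZero m]

lemma norm_unitDirection (v : Euc m) : ‖unitDirection v‖ = 1 := by
  unfold unitDirection
  split_ifs with h
  · simp
  · simp [norm_smul, h]

lemma norm_smul_unitDirection (v : Euc m) : ‖v‖ • unitDirection v = v := by
  unfold unitDirection
  split_ifs with h
  · simp [h]
  · rw [smul_smul, mul_inv_cancel₀ (norm_ne_zero_iff.2 h), one_smul]

lemma norm_signOf_smul_unitDirection (v : Euc m) (K S : Bool) :
    ‖(signOf K * signOf S) • unitDirection v‖ = 1 := by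
  rw [norm_smul, norm_unitDirection]
  cases K <;> cases S <;> simp [signOf]

lemma signOf_smul_unitDirection_ne_zero (v : Euc m) (K S : Bool) :
    (signOf K * signOf S) • unitDirection v ≠ 0 := by
  rw [← norm_ne_zero_iff, norm_signOf_smul_unitDirection]
  exact one_ne_zero

lemma duchiLaw_apply (α r : ℝ) (v : Euc m) (R : Set (Euc m)) :
    duchiLaw m α r v R =
      bernoulliWeight (Real.exp α / (Real.exp α + 1)) true *
        (bernoulliWeight (1 / 2 + ‖v‖ / (2 * r)) true *
            uniformHalfSphere (duchiRadius m α r) (unitDirection v) R +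
          bernoulliWeight (1 / 2 + ‖v‖ / (2 * r)) false *
            uniformHalfSphere (duchiRadius m α r) (-unitDirection v) R) +
      bernoulliWeight (Real.exp α / (Real.exp α + 1)) false *
        (bernoulliWeight (1 / 2 + ‖v‖ / (2 * r)) true *
            uniformHalfSphere (duchiRadius m α r) (-unitDirection v) R +
          bernoulliWeight (1 / 2 + ‖v‖ / (2 * r)) false *
            uniformHalfSphere (duchiRadius m α r) (unitDirection v) R) := by
  simp only [duchiLaw, Fintype.sum_bool, Measure.add_apply, Measure.smul_apply, smul_eq_mul,
    signOf, if_true, Bool.false_eq_true, if_false, mul_one, mul_neg, neg_neg, one_smul,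
    neg_smul]
  ring

/-- The two opposite half-sphere laws have the same sum for every input. Each output law lies
between that sum times the probability of `K = 0` and that sum times the probability of `K = 1`, and
these probabilities have ratio `e^α`. -/
lemma isPrivate_duchiChannel : duchiChannel.IsPrivate := by
  intro m _ α r hα hr R hR v v'
  change duchiLaw m α r (v : Euc m) R ≤ ENNReal.ofReal (Real.exp α) * duchiLaw m α r (v' : Euc m) R
  have he := Real.exp_pos α
  have he1 : 1 < Real.exp α := Real.one_lt_exp_iff.2 hα
  have hw : ∀ v : EucBall m r, bernoulliWeight (1 / 2 + ‖(v : Euc m)‖ / (2 * r)) true +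
      bernoulliWeight (1 / 2 + ‖(v : Euc m)‖ / (2 * r)) false = 1 := fun v =>
    bernoulliWeight_sum (half_add_div_mem (mem_closedBall_zero_iff.1 v.2) hr).1
      (half_add_div_mem (mem_closedBall_zero_iff.1 v.2) hr).2
  have hq : bernoulliWeight (Real.exp α / (Real.exp α + 1)) true =
      ENNReal.ofReal (Real.exp α) * bernoulliWeight (Real.exp α / (Real.exp α + 1)) false := by
    simp only [bernoulliWeight, if_true, Bool.false_eq_true, if_false]
    rw [← ENNReal.ofReal_mul he.le]
    congr 1
    field_simp
    ring
  have hqp : bernoulliWeight (Real.exp α / (Real.exp α + 1)) false ≤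
      bernoulliWeight (Real.exp α / (Real.exp α + 1)) true := by
    rw [hq]
    exact le_mul_of_one_le_left zero_le (ENNReal.one_le_ofReal.2 he1.le)
  rw [duchiLaw_apply, duchiLaw_apply]
  refine (mixture_bounds hqp (hw v)).2.trans ?_
  refine le_trans ?_ (mul_le_mul_right (mixture_bounds hqp (hw v')).1 _)
  rw [uniformHalfSphere_add_neg _ (unitDirection_ne_zero _) hR,
    uniformHalfSphere_add_neg _ (unitDirection_ne_zero _) hR, hq, mul_assoc]

lemma integral_duchiLaw {α r : ℝ} {v : Euc m} (hv : ‖v‖ ≤ r) (hr : 0 < r) {φ : Euc m → ℝ}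
    (hφ : Continuous φ) :
    ∫ y, φ y ∂(duchiLaw m α r v) =
      ∑ K : Bool, ∑ S : Bool,
        (if K then Real.exp α / (Real.exp α + 1) else 1 - Real.exp α / (Real.exp α + 1)) *
          (if S then 1 / 2 + ‖v‖ / (2 * r) else 1 - (1 / 2 + ‖v‖ / (2 * r))) *
          ∫ y, φ y ∂(uniformHalfSphere (duchiRadius m α r)
            ((signOf K * signOf S) • unitDirection v)) := by
  have hint : ∀ (B : ℝ) (u : Euc m), Integrable φ (uniformHalfSphere B u) := fun B u => by
    rw [uniformHalfSphere, integrable_map_measure hφ.aestronglyMeasurable (by fun_prop)]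
    exact (hφ.comp (by fun_prop)).integrable_of_hasCompactSupport
      (HasCompactSupport.of_compactSpace _)
  have he := Real.exp_pos α
  have hp : Real.exp α / (Real.exp α + 1) ≤ 1 := by
    rw [div_le_one (by positivity)]; linarith
  have hs := half_add_div_mem hv hr
  have htop : ∀ (p : ℝ) (b : Bool), bernoulliWeight p b ≠ ∞ := fun p b => by
    cases b <;> simp [bernoulliWeight]
  have hreal : ∀ (p : ℝ), 0 ≤ p → p ≤ 1 → ∀ b : Bool,
      (bernoulliWeight p b).toReal = if b then p else 1 - p := fun p h0 h1 b => by
    cases b <;> simp [bernoulliWeight, h0, h1]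
  rw [duchiLaw, integral_finsetSum_measure fun K _ => integrable_finsetSum_measure.2 fun S _ =>
    (hint _ _).smul_measure (ENNReal.mul_ne_top (htop _ _) (htop _ _))]
  refine Finset.sum_congr rfl fun K _ => ?_
  rw [integral_finsetSum_measure fun S _ =>
    (hint _ _).smul_measure (ENNReal.mul_ne_top (htop _ _) (htop _ _))]
  refine Finset.sum_congr rfl fun S _ => ?_
  rw [integral_smul_measure, ENNReal.toReal_mul, hreal _ (by positivity) hp,
    hreal _ hs.1 hs.2, smul_eq_mul]

/-- The sphere-sampling channel is unbiased. -/
lemma integral_inner_duchiLaw {α r : ℝ} {v : Euc m} (hv : ‖v‖ ≤ r) (hr : 0 < r) (hα : 0 < α)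
    (e : Euc m) : ∫ y, inner ℝ e y ∂(duchiLaw m α r v) = inner ℝ e v := by
  have hm : (0 : ℝ) < m := by exact_mod_cast Nat.pos_of_ne_zero (NeZero.ne m)
  have hG := Real.Gamma_pos_of_pos (s := (m : ℝ) / 2) (by positivity)
  have hG' := Real.Gamma_pos_of_pos (s := ((m : ℝ) + 1) / 2) (by positivity)
  have hpi : 0 < √Real.pi := Real.sqrt_pos.2 Real.pi_pos
  have he1 : 0 < Real.exp α - 1 := sub_pos.2 (Real.one_lt_exp_iff.2 hα)
  have he := Real.exp_pos α
  rw [integral_duchiLaw hv hr (by fun_prop)]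
  simp only [integral_inner_uniformHalfSphere _ (norm_signOf_smul_unitDirection v _ _)]
  have hv' : inner ℝ e v = ‖v‖ * inner ℝ (unitDirection v) e := by
    rw [← real_inner_smul_left, norm_smul_unitDirection, real_inner_comm]
  rw [hv']
  simp only [Fintype.sum_bool, signOf, if_true, Bool.false_eq_true, if_false, real_inner_smul_left,
    duchiRadius]
  -- The two signs have means `(e^α - 1) / (e^α + 1)` and `‖v‖ / r`. With `Γ(m/2 + 1) = (m/2)
  -- Γ(m/2)`, the radius times the first moment of the half sphere is `r (e^α + 1) / (e^α - 1)`, so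
  -- the product is `‖v‖`.
  rw [Real.Gamma_add_one (by positivity)]
  field_simp
  ring

/-- Each coordinate of the output of the sphere-sampling channel has second moment `B² / m`. -/
lemma integral_inner_sq_duchiLaw {α r : ℝ} {v : Euc m} (hv : ‖v‖ ≤ r) (hr : 0 < r) {e : Euc m}
    (he : ‖e‖ = 1) :
    ∫ y, inner ℝ e y ^ 2 ∂(duchiLaw m α r v) = duchiRadius m α r ^ 2 / m := by
  rw [integral_duchiLaw hv hr (by fun_prop)]
  simp only [integral_inner_sq_uniformHalfSphere _ (signOf_smul_unitDirection_ne_zero v _ _) he]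
  simp only [Fintype.sum_bool, if_true, Bool.false_eq_true, if_false]
  ring

/-- Log-convexity of `Γ` at the midpoint of `m/2` and `m/2 + 1`. -/
lemma gamma_ratio_sq_le :
    (Real.Gamma (((m : ℝ) + 1) / 2) / Real.Gamma ((m : ℝ) / 2 + 1)) ^ 2 ≤ 2 / m := by
  have hm : (0 : ℝ) < m := by exact_mod_cast Nat.pos_of_ne_zero (NeZero.ne m)
  have hG := Real.Gamma_pos_of_pos (s := (m : ℝ) / 2) (by positivity)
  have hG' := Real.Gamma_pos_of_pos (s := ((m : ℝ) + 1) / 2) (by positivity)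
  have h := Real.Gamma_mul_add_mul_le_rpow_Gamma_mul_rpow_Gamma (s := (m : ℝ) / 2)
    (t := (m : ℝ) / 2 + 1) (a := 1 / 2) (b := 1 / 2) (by positivity) (by positivity) (by norm_num)
    (by norm_num) (by norm_num)
  rw [show 1 / 2 * ((m : ℝ) / 2) + 1 / 2 * ((m : ℝ) / 2 + 1) = ((m : ℝ) + 1) / 2 by ring,
    ← Real.sqrt_eq_rpow, ← Real.sqrt_eq_rpow, Real.Gamma_add_one (by positivity)] at h
  have h2 := pow_le_pow_left₀ hG'.le h 2
  rw [mul_pow, Real.sq_sqrt hG.le, Real.sq_sqrt (by positivity)] at h2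
  rw [Real.Gamma_add_one (by positivity), div_pow, div_le_div_iff₀ (by positivity) hm]
  calc Real.Gamma (((m : ℝ) + 1) / 2) ^ 2 * m
      ≤ Real.Gamma ((m : ℝ) / 2) * ((m : ℝ) / 2 * Real.Gamma ((m : ℝ) / 2)) * m := by gcongr
    _ = _ := by ring

/-- From `e^α - 1 ≥ α` the quotient is at most `1 + 2/α`, and `(α + 2)² ≤ 9 max(1, α²)`. -/
lemma exp_add_one_div_sub_one_sq_le {α : ℝ} (hα : 0 < α) :
    ((Real.exp α + 1) / (Real.exp α - 1)) ^ 2 ≤ 9 * max 1 (α ^ 2) / α ^ 2 := by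
  have he : α ≤ Real.exp α - 1 := by linarith [Real.add_one_le_exp α]
  have h1 : (Real.exp α + 1) / (Real.exp α - 1) ≤ (α + 2) / α := by
    rw [div_le_div_iff₀ (by linarith) hα]
    nlinarith
  have h0 : 0 ≤ (Real.exp α + 1) / (Real.exp α - 1) :=
    div_nonneg (by positivity) (by linarith)
  calc ((Real.exp α + 1) / (Real.exp α - 1)) ^ 2 ≤ ((α + 2) / α) ^ 2 := by gcongr
    _ = (α + 2) ^ 2 / α ^ 2 := div_pow _ _ _
    _ ≤ _ := by
      gcongr
      rcases le_total α 1 with h | h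
      · have := le_max_left 1 (α ^ 2)
        nlinarith
      · have := le_max_right 1 (α ^ 2)
        nlinarith

/-- The constant is `(π/4) · 9 · 2 < 16`. -/
lemma duchiRadius_sq_div_le {α r : ℝ} (hα : 0 < α) :
    duchiRadius m α r ^ 2 / m ≤ 16 * max 1 (α ^ 2) * r ^ 2 / α ^ 2 := by
  have hm : (0 : ℝ) < m := by exact_mod_cast Nat.pos_of_ne_zero (NeZero.ne m)
  have h1 := gamma_ratio_sq_le (m := m)
  have h2 := exp_add_one_div_sub_one_sq_le hα
  have hpi : Real.pi ≤ 3.15 := Real.pi_lt_d2.le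
  have hmax : 0 ≤ max 1 (α ^ 2) := zero_le_one.trans (le_max_left _ _)
  calc duchiRadius m α r ^ 2 / m
      = Real.pi / 4 * m * r ^ 2 * ((Real.exp α + 1) / (Real.exp α - 1)) ^ 2 *
          (Real.Gamma (((m : ℝ) + 1) / 2) / Real.Gamma ((m : ℝ) / 2 + 1)) ^ 2 := by
        have hpi2 := Real.sq_sqrt Real.pi_pos.le
        rw [duchiRadius, mul_pow, mul_pow, mul_pow, mul_pow, div_pow, hpi2]
        field_simp
        ring
    _ ≤ 3.15 / 4 * m * r ^ 2 * (9 * max 1 (α ^ 2) / α ^ 2) * (2 / m) := by gcongr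
    _ = (3.15 * 9 / 2) * max 1 (α ^ 2) * r ^ 2 / α ^ 2 := by field_simp; ring
    _ ≤ _ := by gcongr; norm_num

end Duchi

/-! ### The mean-squared error -/

section Error

lemma duchiLaw_ae_norm_le {m : ℕ} [NeZero m] (α r : ℝ) (v : Euc m) :
    ∀ᵐ y ∂(duchiLaw m α r v), ‖y‖ ≤ |duchiRadius m α r| := by
  simp only [duchiLaw, Fintype.sum_bool, ae_add_measure_iff]
  refine ⟨⟨?_, ?_⟩, ?_, ?_⟩ <;>
    exact Measure.ae_smul_measure (uniformHalfSphere_ae_norm _ _) _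

variable {d : ℕ} {c : Fin d → ℝ}

lemma memLp_coord_roundLaw (c : Fin d → ℝ) (x : Cube d) (k : Fin d) (t : Fin (d - (k : ℕ))) :
    MemLp (fun y : Euc (d - (k : ℕ)) => y t) 2 (roundLaw duchiChannel c x k) := by
  have hmeas : AEStronglyMeasurable (fun y : Euc (d - (k : ℕ)) => y t)
      (roundLaw duchiChannel c x k) := by
    apply Continuous.aestronglyMeasurable; fun_prop
  refine MemLp.of_bound hmeas
    |duchiRadius (d - (k : ℕ)) (budget c k) √((d - (k : ℕ) : ℕ) : ℝ)| ?_
  have h : ∀ᵐ y ∂(roundLaw duchiChannel c x k),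
      ‖y‖ ≤ |duchiRadius (d - (k : ℕ)) (budget c k) √((d - (k : ℕ) : ℕ) : ℝ)| := by
    unfold roundLaw
    split_ifs
    · rw [ae_dirac_iff (measurableSet_le measurable_norm measurable_const)]
      simp
    · exact duchiLaw_ae_norm_le _ _ _
  filter_upwards [h] with y hy using (PiLp.norm_apply_le y t).trans hy

lemma cast_sub_pos (k : Fin d) : (0 : ℝ) < ((d - (k : ℕ) : ℕ) : ℝ) := by
  have := k.2
  exact_mod_cast Nat.sub_pos_of_lt this

lemma roundLaw_duchiChannel_of_ne {k : Fin d} (hk : budget c k ≠ 0) (x : Cube d) :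
    roundLaw duchiChannel c x k =
      duchiLaw (d - (k : ℕ)) (budget c k) √((d - (k : ℕ) : ℕ) : ℝ) (x.tail k) := by
  rw [roundLaw, if_neg hk]
  rfl

/-- The factor `weight c k` covers rounds of zero budget, whose replaced law is concentrated at `0`
and need not be unbiased. -/
lemma weight_mul_integral_roundLaw (hb : ∀ k, 0 ≤ budget c k) (x : Cube d) (k : Fin d)
    (t : Fin (d - (k : ℕ))) :
    weight c k * ∫ y, y t ∂(roundLaw duchiChannel c x k) = weight c k * x.tail k t := by
  by_cases hk : budget c k = 0
  · simp [weight, hk]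
  · have h := integral_inner_duchiLaw (mem_closedBall_zero_iff.1 (x.tail_mem_ball k))
      (Real.sqrt_pos.2 (cast_sub_pos k)) (lt_of_le_of_ne (hb k) (Ne.symm hk))
      (EuclideanSpace.single t (1 : ℝ))
    simp only [EuclideanSpace.inner_single_left, map_one, one_mul] at h
    rw [roundLaw_duchiChannel_of_ne hk, h]

lemma weight_nonneg (c : Fin d → ℝ) (k : Fin d) : 0 ≤ weight c k := by
  unfold weight; positivity

/-- With `r² = d - k`, the second moment bound of the channel is `16 max(1, budget²)` divided by the
weight. -/
lemma weight_sq_mul_variance_roundLaw_le {D : ℝ} (hb : ∀ k, 0 ≤ budget c k)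
    (hD : ∀ k, budget c k ≤ D) (x : Cube d) (k : Fin d) (t : Fin (d - (k : ℕ))) :
    weight c k ^ 2 * variance (fun y => y t) (roundLaw duchiChannel c x k) ≤
      16 * max 1 (D ^ 2) * weight c k := by
  by_cases hk : budget c k = 0
  · simp [weight, hk]
  · have hk' : 0 < budget c k := lt_of_le_of_ne (hb k) (Ne.symm hk)
    have hdk := cast_sub_pos k
    have h1 : variance (fun y => y t) (roundLaw duchiChannel c x k) ≤
        16 * max 1 (budget c k ^ 2) * √((d - (k : ℕ) : ℕ) : ℝ) ^ 2 / budget c k ^ 2 := by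
      refine (variance_le_expectation_sq
        (memLp_coord_roundLaw c x k t).aestronglyMeasurable).trans ?_
      have h := integral_inner_sq_duchiLaw (α := budget c k)
        (mem_closedBall_zero_iff.1 (x.tail_mem_ball k))
        (Real.sqrt_pos.2 (cast_sub_pos k)) (e := EuclideanSpace.single t (1 : ℝ)) (by simp)
      simp only [EuclideanSpace.inner_single_left, map_one, one_mul] at h
      rw [roundLaw_duchiChannel_of_ne hk]
      refine (le_of_eq ?_).trans (duchiRadius_sq_div_le (m := d - (k : ℕ)) hk')
      exact h
    rw [Real.sq_sqrt hdk.le] at h1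
    have hmax : max 1 (budget c k ^ 2) ≤ max 1 (D ^ 2) :=
      max_le_max le_rfl (pow_le_pow_left₀ (hb k) (hD k) 2)
    calc weight c k ^ 2 * variance (fun y => y t) (roundLaw duchiChannel c x k)
        ≤ weight c k ^ 2 *
          (16 * max 1 (budget c k ^ 2) * ((d - (k : ℕ) : ℕ) : ℝ) / budget c k ^ 2) := by gcongr
      _ = 16 * max 1 (budget c k ^ 2) * weight c k := by
          unfold weight
          field_simp
      _ ≤ _ := by
          have := weight_nonneg c k
          gcongr

/-- The contribution of round `k` to the estimate of the `i`-th coordinate. -/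
noncomputable def roundTerm (c : Fin d → ℝ) (i k : Fin d) (y : Euc (d - (k : ℕ))) : ℝ :=
  if h : k ≤ i then
    (weight c k / ∑ k ∈ Finset.Iic i, weight c k) *
      y ⟨(i : ℕ) - (k : ℕ), by have := Fin.le_def.1 h; omega⟩
  else 0

lemma weightedEstimate_apply (c : Fin d → ℝ) (Y : ∀ k : Fin d, Euc (d - (k : ℕ))) (i : Fin d) :
    weightedEstimate c Y i = ∑ k, roundTerm c i k (Y k) := by
  simp only [weightedEstimate, roundTerm]
  rw [Finset.sum_div]
  refine Finset.sum_congr rfl fun k _ => ?_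
  split_ifs <;> ring

lemma memLp_roundTerm (c : Fin d → ℝ) (x : Cube d) (i k : Fin d) :
    MemLp (roundTerm c i k) 2 (roundLaw duchiChannel c x k) := by
  unfold roundTerm
  split_ifs
  · exact (memLp_coord_roundLaw c x k _).const_mul _
  · exact memLp_const 0

lemma integral_roundTerm (hb : ∀ k, 0 ≤ budget c k) (x : Cube d) (i k : Fin d) :
    ∫ y, roundTerm c i k y ∂(roundLaw duchiChannel c x k) =
      if k ≤ i then weight c k / (∑ k ∈ Finset.Iic i, weight c k) * x i else 0 := by
  unfold roundTerm
  split_ifs with h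
  · have hki := Fin.le_def.1 h
    rw [integral_const_mul, div_mul_eq_mul_div, weight_mul_integral_roundLaw hb, mul_div_right_comm]
    congr 2
    simp only [Cube.tail]
    congr 2
    exact Fin.ext (by simp only; omega)
  · simp

lemma variance_roundTerm_le {D : ℝ} (hb : ∀ k, 0 ≤ budget c k)
    (hD : ∀ k, budget c k ≤ D) (x : Cube d) (i k : Fin d) :
    variance (roundTerm c i k) (roundLaw duchiChannel c x k) ≤
      if k ≤ i then 16 * max 1 (D ^ 2) * weight c k / (∑ k ∈ Finset.Iic i, weight c k) ^ 2
      else 0 := by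
  unfold roundTerm
  split_ifs with h
  · rw [variance_const_mul, div_pow, div_mul_eq_mul_div]
    refine div_le_div_of_nonneg_right ?_ (sq_nonneg _)
    exact weight_sq_mul_variance_roundLaw_le hb hD x k _
  · exact (variance_zero _).le

lemma measurable_coord (i : Fin d) : Measurable fun y : Euc d => y i := by fun_prop

lemma coord_comp_weightedEstimate (c : Fin d → ℝ) (i : Fin d) :
    (fun y : Euc d => y i) ∘ weightedEstimate c =
      ∑ k, fun Y : ∀ k : Fin d, Euc (d - (k : ℕ)) => roundTerm c i k (Y k) := by
  funext Y
  simp [weightedEstimate_apply]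

lemma memLp_coord_meanMechanism (c : Fin d → ℝ) (x : Cube d) (i : Fin d) :
    MemLp (fun y : Euc d => y i) 2 (meanMechanism duchiChannel c x) := by
  rw [meanMechanism_eq_map_roundLaw, memLp_map_measure_iff
    (measurable_coord i).aestronglyMeasurable (measurable_weightedEstimate c).aemeasurable,
    coord_comp_weightedEstimate]
  exact memLp_finsetSum' _ fun k _ =>
    (memLp_roundTerm c x i k).comp_measurePreserving (measurePreserving_eval _ k)

/-- The mechanism is unbiased in the coordinates that carry positive weight. -/
lemma integral_coord_meanMechanism (hb : ∀ k, 0 ≤ budget c k) (x : Cube d) (i : Fin d)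
    (hW : 0 < ∑ k ∈ Finset.Iic i, weight c k) :
    ∫ y, y i ∂(meanMechanism duchiChannel c x) = x i := by
  rw [meanMechanism_eq_map_roundLaw, integral_map (measurable_weightedEstimate c).aemeasurable
    (measurable_coord i).aestronglyMeasurable]
  simp only [weightedEstimate_apply]
  have hint : ∀ k, Integrable (fun Y : ∀ k : Fin d, Euc (d - (k : ℕ)) => roundTerm c i k (Y k))
      (Measure.pi (roundLaw duchiChannel c x)) := fun k =>
    ((memLp_roundTerm c x i k).comp_measurePreserving
      (measurePreserving_eval _ k)).integrable one_le_two
  rw [integral_finsetSum _ fun k _ => hint k]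
  have h : ∀ k, ∫ Y : ∀ k : Fin d, Euc (d - (k : ℕ)), roundTerm c i k (Y k)
      ∂(Measure.pi (roundLaw duchiChannel c x)) =
      if k ≤ i then weight c k / (∑ k ∈ Finset.Iic i, weight c k) * x i else 0 := fun k => by
    rw [integral_comp_eval (memLp_roundTerm c x i k).aestronglyMeasurable,
      integral_roundTerm hb]
  simp only [h]
  rw [← Finset.sum_filter, ← Finset.sum_mul, ← Finset.sum_div,
    show Finset.univ.filter (fun k => k ≤ i) = Finset.Iic i by ext k; simp,
    div_self hW.ne', one_mul]

/-- Inverse-variance weighting: with total weight `W`, the independent terms contribute `∑ w_k² · (1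
/ w_k) / W² = 1 / W`, up to the constant. -/
lemma variance_coord_meanMechanism_le {D : ℝ} (hb : ∀ k, 0 ≤ budget c k)
    (hD : ∀ k, budget c k ≤ D) (x : Cube d) (i : Fin d)
    (hW : 0 < ∑ k ∈ Finset.Iic i, weight c k) :
    variance (fun y => y i) (meanMechanism duchiChannel c x) ≤
      16 * max 1 (D ^ 2) / ∑ k ∈ Finset.Iic i, weight c k := by
  rw [meanMechanism_eq_map_roundLaw, variance_map (measurable_coord i).aemeasurable
    (measurable_weightedEstimate c).aemeasurable, coord_comp_weightedEstimate,
    variance_sum_pi fun k => memLp_roundTerm c x i k]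
  calc ∑ k, variance (roundTerm c i k) (roundLaw duchiChannel c x k)
      ≤ ∑ k, if k ≤ i then
          16 * max 1 (D ^ 2) * weight c k / (∑ k ∈ Finset.Iic i, weight c k) ^ 2 else 0 :=
        Finset.sum_le_sum fun k _ => variance_roundTerm_le hb hD x i k
    _ = _ := by
        rw [← Finset.sum_filter, ← Finset.sum_div, ← Finset.mul_sum,
          show Finset.univ.filter (fun k => k ≤ i) = Finset.Iic i by ext k; simp]
        field_simp

/-- The mean-squared error of an average of independent unbiased estimates. -/
lemma lintegral_sq_average_le {n : ℕ} (hn : 0 < n) {Ω : Type*} [MeasurableSpace Ω]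
    {μ : Fin n → Measure Ω} [∀ j, IsProbabilityMeasure (μ j)] {f : Ω → ℝ}
    (hf : ∀ j, MemLp f 2 (μ j)) {V : ℝ} (hV : ∀ j, variance f (μ j) ≤ V) :
    ∫⁻ y, ENNReal.ofReal (((n : ℝ)⁻¹ * ∑ j, ∫ ω, f ω ∂(μ j) - (n : ℝ)⁻¹ * ∑ j, f (y j)) ^ 2)
      ∂(Measure.pi μ) ≤ ENNReal.ofReal (V / n) := by
  have hn' : (0 : ℝ) < n := by exact_mod_cast hn
  have hF : ∀ j, MemLp (fun ω => (n : ℝ)⁻¹ * f ω) 2 (μ j) := fun j => (hf j).const_mul _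
  have hFe : ∀ j, MemLp (fun y : Fin n → Ω => (n : ℝ)⁻¹ * f (y j)) 2 (Measure.pi μ) := fun j =>
    (hF j).comp_measurePreserving (measurePreserving_eval _ j)
  have hsum : MemLp (∑ j, fun y : Fin n → Ω => (n : ℝ)⁻¹ * f (y j)) 2 (Measure.pi μ) :=
    memLp_finsetSum' _ fun j _ => hFe j
  have hmean : ∫ y, (∑ j, fun y : Fin n → Ω => (n : ℝ)⁻¹ * f (y j)) y ∂(Measure.pi μ) =
      (n : ℝ)⁻¹ * ∑ j, ∫ ω, f ω ∂(μ j) := by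
    simp only [Finset.sum_apply]
    rw [integral_finsetSum _ fun j _ => (hFe j).integrable one_le_two, Finset.mul_sum]
    refine Finset.sum_congr rfl fun j _ => ?_
    rw [integral_comp_eval (μ := μ) (f := fun ω => (n : ℝ)⁻¹ * f ω) (hF j).aestronglyMeasurable,
      integral_const_mul]
  have hvar := variance_sum_pi hF
  -- The subtracted constant is exactly the mean of the average, so the squared error is a variance.
  calc _ = evariance (∑ j, fun y : Fin n → Ω => (n : ℝ)⁻¹ * f (y j)) (Measure.pi μ) := by
        rw [evariance_eq_lintegral_ofReal, hmean]
        refine lintegral_congr fun y => ?_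
        rw [Finset.sum_apply, ← Finset.mul_sum]
        congr 1
        ring
    _ = ENNReal.ofReal (∑ j, variance (fun ω => (n : ℝ)⁻¹ * f ω) (μ j)) := by
        rw [← hvar, hsum.ofReal_variance_eq]
    _ ≤ ENNReal.ofReal (V / n) := by
        refine ENNReal.ofReal_le_ofReal ?_
        calc ∑ j, variance (fun ω => (n : ℝ)⁻¹ * f ω) (μ j)
            ≤ ∑ _j : Fin n, (n : ℝ)⁻¹ ^ 2 * V := Finset.sum_le_sum fun j _ => by
              rw [variance_const_mul]
              exact mul_le_mul_of_nonneg_left (hV j) (by positivity)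
          _ = V / n := by
              simp only [Finset.sum_const, Finset.card_univ, Fintype.card_fin, nsmul_eq_mul]
              field_simp

/-! ### Error of the projected average -/

lemma average_mem_Icc {n : ℕ} (hn : 0 < n) (x : Fin n → Cube d) (i : Fin d) :
    -1 ≤ (n : ℝ)⁻¹ * ∑ j, (x j i : ℝ) ∧ (n : ℝ)⁻¹ * ∑ j, (x j i : ℝ) ≤ 1 := by
  have hn' : (0 : ℝ) < n := by exact_mod_cast hn
  rw [inv_mul_eq_div, le_div_iff₀ hn', div_le_iff₀ hn']
  constructor
  · calc -1 * (n : ℝ) = ∑ _j : Fin n, (-1 : ℝ) := by simp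
      _ ≤ _ := Finset.sum_le_sum fun j _ => (x j i).2.1
  · calc ∑ j, (x j i : ℝ) ≤ ∑ _j : Fin n, (1 : ℝ) := Finset.sum_le_sum fun j _ => (x j i).2.2
      _ = _ := by simp

/-- Clamping is a contraction that fixes `a`, and two points of `[-1,1]` are at distance at most
`2`. -/
lemma sq_sub_clamp_le {a : ℝ} (ha : -1 ≤ a ∧ a ≤ 1) (b : ℝ) :
    (a - max (-1) (min 1 b)) ^ 2 ≤ (a - b) ^ 2 ∧ (a - max (-1) (min 1 b)) ^ 2 ≤ 4 := by
  rcases max_cases (-1 : ℝ) (min 1 b) with h1 | h1 <;>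
    rcases min_cases (1 : ℝ) b with h2 | h2 <;> constructor <;> rw [h1.1] <;>
    (try rw [h2.1]) <;> nlinarith [ha.1, ha.2]

lemma norm_sq_average_sub_proj {n : ℕ} (x : Fin n → Cube d) (y : Fin n → Euc d) :
    ‖(n : ℝ)⁻¹ • ∑ j, (x j).toEuc - projCube ((n : ℝ)⁻¹ • ∑ j, y j)‖ ^ 2 =
      ∑ i, ((n : ℝ)⁻¹ * ∑ j, (x j i : ℝ) -
        max (-1) (min 1 ((n : ℝ)⁻¹ * ∑ j, y j i))) ^ 2 := by
  rw [EuclideanSpace.norm_sq_eq]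
  refine Finset.sum_congr rfl fun i _ => ?_
  simp [projCube, Cube.toEuc]

lemma meanSquaredError_le_dim {n : ℕ} (hn : 0 < n) (κ : Kernel (Cube d) (Euc d))
    [IsMarkovKernel κ] (x : Fin n → Cube d) :
    meanSquaredError κ x ≤ 4 * d := by
  unfold meanSquaredError
  calc _ ≤ ∫⁻ _y : Fin n → Euc d, ENNReal.ofReal (4 * d) ∂(Measure.pi fun j : Fin n => κ (x j)) := by
        refine lintegral_mono fun y => ENNReal.ofReal_le_ofReal ?_
        rw [norm_sq_average_sub_proj]
        calc _ ≤ ∑ _i : Fin d, (4 : ℝ) :=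
              Finset.sum_le_sum fun i _ => (sq_sub_clamp_le (average_mem_Icc hn x i) _).2
          _ = _ := by simp [mul_comm]
    _ = 4 * d := by simp [ENNReal.ofReal_mul]

lemma meanSquaredError_meanMechanism_le {n : ℕ} (hn : 0 < n) {D : ℝ} (hb : ∀ k, 0 ≤ budget c k)
    (hD : ∀ k, budget c k ≤ D) (hW : ∀ i, 0 < ∑ k ∈ Finset.Iic i, weight c k)
    (x : Fin n → Cube d) :
    meanSquaredError (meanMechanism duchiChannel c) x ≤
      ENNReal.ofReal 16 * (ENNReal.ofReal (max 1 (D ^ 2)) *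
        ((n : ℝ≥0∞)⁻¹ * ∑ i, (ENNReal.ofReal (∑ k ∈ Finset.Iic i, weight c k))⁻¹)) := by
  have hn' : (0 : ℝ) < n := by exact_mod_cast hn
  unfold meanSquaredError
  calc _ ≤ ∫⁻ y, ∑ i, ENNReal.ofReal (((n : ℝ)⁻¹ * ∑ j, (x j i : ℝ) -
          (n : ℝ)⁻¹ * ∑ j, y j i) ^ 2)
          ∂(Measure.pi fun j : Fin n => meanMechanism duchiChannel c (x j)) := by
        refine lintegral_mono fun y => ?_
        rw [norm_sq_average_sub_proj, ENNReal.ofReal_sum_of_nonneg fun _ _ => sq_nonneg _]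
        exact Finset.sum_le_sum fun i _ =>
          ENNReal.ofReal_le_ofReal (sq_sub_clamp_le (average_mem_Icc hn x i) _).1
    _ = ∑ i, ∫⁻ y, ENNReal.ofReal (((n : ℝ)⁻¹ * ∑ j, (x j i : ℝ) -
          (n : ℝ)⁻¹ * ∑ j, y j i) ^ 2)
          ∂(Measure.pi fun j : Fin n => meanMechanism duchiChannel c (x j)) :=
        lintegral_finsetSum _ fun i _ => by fun_prop
    _ ≤ ∑ i, ENNReal.ofReal (16 * max 1 (D ^ 2) / (∑ k ∈ Finset.Iic i, weight c k) / n) := by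
        refine Finset.sum_le_sum fun i _ => ?_
        have h := lintegral_sq_average_le hn (fun j => memLp_coord_meanMechanism c (x j) i)
          (fun j => variance_coord_meanMechanism_le hb hD (x j) i (hW i))
        simpa only [integral_coord_meanMechanism hb _ i (hW i)] using h
    _ = _ := by
        rw [Finset.mul_sum, Finset.mul_sum, Finset.mul_sum]
        refine Finset.sum_congr rfl fun i _ => ?_
        rw [ENNReal.ofReal_div_of_pos hn', ENNReal.ofReal_div_of_pos (hW i),
          ENNReal.ofReal_mul (by norm_num), ENNReal.ofReal_natCast, ENNReal.div_eq_inv_mul,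
          ENNReal.div_eq_inv_mul]
        ring

lemma meanSquaredError_meanMechanism_le_min {n : ℕ} (hn : 0 < n) {D : ℝ}
    (hb : ∀ k, 0 ≤ budget c k) (hD : ∀ k, budget c k ≤ D) (x : Fin n → Cube d) :
    meanSquaredError (meanMechanism duchiChannel c) x ≤
      ENNReal.ofReal 16 * min (ENNReal.ofReal (max 1 (D ^ 2)) *
        ((n : ℝ≥0∞)⁻¹ * ∑ i, (ENNReal.ofReal (∑ k ∈ Finset.Iic i, weight c k))⁻¹)) d := by
  have hdim : meanSquaredError (meanMechanism duchiChannel c) x ≤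
      ENNReal.ofReal 16 * d := by
    refine (meanSquaredError_le_dim hn _ x).trans ?_
    gcongr
    rw [show (4 : ℝ≥0∞) = ENNReal.ofReal 4 by simp]
    exact ENNReal.ofReal_le_ofReal (by norm_num)
  rcases min_choice (ENNReal.ofReal (max 1 (D ^ 2)) *
    ((n : ℝ≥0∞)⁻¹ * ∑ i, (ENNReal.ofReal (∑ k ∈ Finset.Iic i, weight c k))⁻¹)) (d : ℝ≥0∞)
    with h | h
  · rw [h]
    by_cases hW : ∀ i, 0 < ∑ k ∈ Finset.Iic i, weight c k
    · exact meanSquaredError_meanMechanism_le hn hb hD hW x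
    -- Some coordinate receives no weight, so its summand is `0⁻¹ = ∞`; the other factors are
    -- nonzero, hence the bound is `∞` and not `0 * ∞ = 0`.
    · obtain ⟨i, hi⟩ := not_forall.1 hW
      have htop : ∑ i, (ENNReal.ofReal (∑ k ∈ Finset.Iic i, weight c k))⁻¹ = ∞ :=
        ENNReal.sum_eq_top.2 ⟨i, Finset.mem_univ _, by
          rw [ENNReal.ofReal_of_nonpos (not_lt.1 hi), ENNReal.inv_zero]⟩
      rw [htop, ENNReal.mul_top (by simp), ENNReal.mul_top (by simp),
        ENNReal.mul_top (by simp)]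
      exact le_top
  · rw [h]
    exact hdim

end Error

/-! ### Assembly of the theorem -/

theorem mainTheorem1 :
    ∃ C : ℝ, 0 < C ∧
      ∀ (d n : ℕ) [NeZero d] (_hn : 0 < n)
        (δ : Fin d → ℝ) (_hδ : ∀ i, 0 ≤ δ i) (_hδmono : Monotone δ)
        (ε q ζ : ℝ) (_hε : 0 ≤ ε) (_hq : 0 ≤ q) (_hζ : 0 < ζ) (_hζ1 : ζ ≤ 1)
        (π : Fin n → MeasureTheory.Measure (Cube d))
        (_hπ : ∀ j, MeasureTheory.IsProbabilityMeasure (π j))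
        (_hTV : ∀ j, HasBoundedDependence (π j) q),
        -- the privacy vector is nonnegative and nondecreasing
        (∀ i, 0 ≤ privacyVector δ ε q ζ i) ∧
        Monotone (privacyVector δ ε q ζ) ∧
        -- privacy, for every black-box locally private channel
        (∀ (M : ChannelFamily)
            [∀ (m : ℕ) [NeZero m] (α r : ℝ), ProbabilityTheory.IsMarkovKernel (M m α r)],
            M.IsPrivate →
              (∀ j, IsBCDP (π j) (meanMechanism M (privacyVector δ ε q ζ)) δ) ∧
              IsLDP (meanMechanism M (privacyVector δ ε q ζ)) ε) ∧
        -- the sphere-sampling channel is such a channel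
        duchiChannel.IsPrivate ∧
        -- error bound with the sphere-sampling channel
        (∀ x : Fin n → Cube d,
            meanSquaredError (meanMechanism duchiChannel (privacyVector δ ε q ζ)) x ≤
              ENNReal.ofReal C *
                min
                  (ENNReal.ofReal (max 1 (privacyVector δ ε q ζ (lastIdx d) ^ 2)) *
                    ((n : ENNReal)⁻¹ *
                      ∑ i : Fin d,
                        (ENNReal.ofReal
                          (∑ k ∈ Finset.Iic i, weight (privacyVector δ ε q ζ) k))⁻¹))
                  (d : ENNReal)) := by
  refine ⟨16, by norm_num, ?_⟩
  intro d n _ hn δ hδ hmono ε q ζ hε hq hζ hζ1 π hπ hTV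
  have h0 := privacyVector_nonneg hδ hmono hε hq hζ hζ1
  have hm := privacyVector_monotone hδ hmono hε hq hζ
  refine ⟨h0, hm, fun M _ hM => ⟨fun j => ?_, ?_⟩, isPrivate_duchiChannel, fun x => ?_⟩
  · have := hπ j
    exact isBCDP_meanMechanism hM hδ hmono hε hq hζ hζ1 (π j) (hTV j)
  · exact isLDP_meanMechanism hM hδ hmono hε hq hζ hζ1
  -- Taken with `D = c_d`: each increment is at most `c_k ≤ c_d`.
  · exact meanSquaredError_meanMechanism_le_min hn (budget_nonneg h0 hm)
      (fun k => (budget_le h0 k).trans (hm (le_lastIdx k))) x
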